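/- **Setting.** Let $d\in\{2,3\}$, $T>0$, and let $\hat\Omega_f,\hat\Omega_p\subset\mathbb R^d$ be disjoint bounded open sets with Lipschitz boundary. The boundary $\partial\hat\Omega_f$ (resp. $\partial\hat\Omega_p$) is, up to a surface null set, the disjoint union of relatively open parts $\hat\Gamma,\hat\Sigma_f^D,\hat\Sigma_f^N$ (resp. $\hat\Gamma,\hat\Sigma_p^D,\hat\Sigma_p^N$), with a common interface $\hat\Gamma$. Let $\rho_f,\mu_f,\rho_p,\mu_p,\lambda_p,\alpha,C_0\in\mathbb R$, $\gamma>0$, and let $\mathbb K$ be a measurable, uniformly bounded and uniformly elliptic tensor field on $\hat\Omega_p$. Let $F_f,g,\hat F_d$ be forcing terms, square integrable in space for a.e. $t$ ($F_f$ locally, $g$ on $\hat\Sigma_f^N$, $\hat F_d$ on $\hat\Omega_p$). Put $\hat V_f=\{\hat v\in H^1(\hat\Omega_f)^d:\hat v=0\text{ on }\hat\Sigma_f^D\}$, $\hat V_p=\{\hat\zeta\in H^1(\hat\Omega_p)^d:\hat\zeta=0\text{ on }\hat\Sigma_p^D\}$, $\hat Q_p=\{\hat\psi\in H^1(\hat\Omega_p):\hat\psi=0\text{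 on }\hat\Sigma_p^D\}$. Fix a degree of smoothness $k\in\{1,2,\dots,\infty\}$. For a displacement $\hat\eta:[0,T]\times\hat\Omega_p\to\mathbb R^d$ let $\Phi_p^t=\mathrm{id}+\hat\eta(t)$ and $\Phi_f^t=\mathrm{id}+\hat\eta_f(t)$, where $\hat\eta_f(t)$ is the harmonic extension: $\Delta\hat\eta_f=0$ in $\hat\Omega_f$, $\hat\eta_f=\hat\eta$ on $\hat\Gamma$, $\hat\eta_f=0$ on $\partial\hat\Omega_f\setminus\hat\Gamma$. It is part of the notion of solution that $\hat\eta,\hat\eta_f$ are $C^k$ in $(t,x)$ up to the boundary (restrictions of $C^k$ functions on $\mathbb R\times\mathbb R^d$) and that $\Phi_p^t,\Phi_f^t$ are injective with invertible derivative on the closures of $\hat\Omega_p,\hat\Omega_f$ for every $t\in[0,T]$. Set $\Omega_f(t)=\Phi_f^t(\hat\Omega_f)$, $\Gamma(t)=\Phi_f^t(\hat\Gamma)$, $\Sigma_f^N(t)=\Phi_f^t(\hat\Sigma_f^N)$, let $\omega=\partial_t\hat\eta_f\circ(\Phi_f^t)^{-1}$ be the domain velocity, $V_f(t)=\{\hat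 v\circ(\Phi^t_f)^{-1}:\hat v\in\hat V_f\}$, $Q_f(t)=\{\hat q\circ(\Phi^t_f)^{-1}:\hat q\in L^2(\hat\Omega_f)\}$. Let $n_f,\hat n_p$ be the outward unit normals of $\Omega_f(t),\hat\Omega_p$, and $P_f,\hat P_p$ the orthogonal projections onto the tangent spaces of $\Gamma(t),\hat\Gamma$. A hat denotes the pull-back of a function by $\Phi^t_f$ (fluid) or $\Phi_p^t$ (structure); $(\cdot,\cdot)_f$, $(\cdot,\cdot)_p$ are the $L^2$ products on $\Omega_f(t)$, $\hat\Omega_p$, $\langle\cdot,\cdot\rangle_S$ is the $L^2(S)$ product with respect to surface measure, $\mathbb D(v)=(\nabla v+\nabla v^T)/2$, and boundary values are traces. All unknown quintuples $(u,p,\hat\eta,\hat\xi,\hat\phi)$ satisfy $\hat\xi=\partial_t\hat\eta$; $\hat u\in H^1(0,T;L^2(\hat\Omega_f)^d)$, $\hat\xi\in H^1(0,T;L^2(\hat\Omega_p)^d)$, $\hat\phi\in H^1(0,T;L^2(\hat\Omega_p))$; for a.e. $t$, $u\in V_f(t)$, $p\in Q_f(t)$, $\hat\eta,\hat\xi\in\hat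 V_p$, $\hat\phi\in\hat Q_p$; and the same prescribed initial values of $\hat u,\hat\eta,\hat\xi,\hat\phi$ at $t=0$. The derivative $\partial_t u|_{\hat x}$ is $(\partial_t\hat u)\circ(\Phi_f^t)^{-1}$. Domains, maps and normals are always those determined by the quintuple's own $\hat\eta$. Abbreviate $$A_f(v)=\rho_f\big[(\partial_tu|_{\hat x},v)_f+((u-\omega)\cdot\nabla u,v)_f\big]+2\mu_f(\mathbb D(u),\mathbb D(v))_f-(p,\nabla\cdot v)_f,\qquad \ell_f(v)=(F_f,v)_f+\langle g,v\rangle_{\Sigma_f^N(t)},$$ $$A_s(\hat\zeta)=\rho_p(\partial_t\hat\xi,\hat\zeta)_p+2\mu_p(\mathbb D(\hat\eta),\mathbb D(\hat\zeta))_p+\lambda_p(\nabla\cdot\hat\eta,\nabla\cdot\hat\zeta)_p-\alpha(\hat\phi,\nabla\cdot\hat\zeta)_p,$$ $$A_d(\hat\psi)=C_0(\partial_t\hat\phi,\hat\psi)_p+\alpha(\nabla\cdot\hat\xi,\hat\psi)_p+(\mathbb K\nabla\hat\phi,\nabla\hat\psi)_p .$$ **Coupled problem.** For a.e. $t\in(0,T)$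 and all $(v,q,\hat\zeta,\hat\psi)\in V_f(t)\times Q_f(t)\times\hat V_p\times\hat Q_p$, $$A_f(v)+(\nabla\cdot u,q)_f+\langle\phi,v\cdot n_f\rangle_{\Gamma(t)}+\gamma\langle P_f(u-\xi),P_f(v)\rangle_{\Gamma(t)}+A_s(\hat\zeta)+A_d(\hat\psi)$$ $$-\gamma\langle\hat P_p(\hat u-\hat\xi),\hat P_p(\hat\zeta)\rangle_{\hat\Gamma}-\langle(\hat\xi-\hat u)\cdot\hat n_p,\hat\psi\rangle_{\hat\Gamma}+\langle\hat\phi,\hat\zeta\cdot\hat n_p\rangle_{\hat\Gamma}=\ell_f(v)+(\hat F_d,\hat\psi)_p .$$ **Decoupled problem.** Let $L_1,L_2,L_3\in\mathbb R$, $R_1,R_2\in L^2(0,T;L^2(\Gamma(t)))$, $R_3,R_4,R_5\in L^2(0,T;L^2(\hat\Gamma))$, where $R_1,R_3,R_4$ are scalar and $R_2$, $R_5$ are tangential vector fields ($P_fR_2=R_2$, $\hat P_pR_5=R_5$). Unknowns carry a subscript $r$. For a.e. $t\in(0,T)$ and all $v\in V_f(t)$, $q\in Q_f(t)$, $\hat\zeta\in\hat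 V_p$, $\hat\psi\in\hat Q_p$, $$A_f(v)+L_1\langle u_r\cdot n_f,v\cdot n_f\rangle_{\Gamma(t)}+\gamma\langle P_f(u_r),P_f(v)\rangle_{\Gamma(t)}=\ell_f(v)+\langle R_2,P_f(v)\rangle_{\Gamma(t)}+\langle R_1,v\cdot n_f\rangle_{\Gamma(t)},\qquad (\nabla\cdot u_r,q)_f=0,$$ $$A_s(\hat\zeta)+\gamma\langle\hat P_p(\hat\xi_r),\hat P_p(\hat\zeta)\rangle_{\hat\Gamma}+\langle\hat\phi_r+L_2\hat\xi_r\cdot\hat n_p,\hat\zeta\cdot\hat n_p\rangle_{\hat\Gamma}=\langle R_3,\hat\zeta\cdot\hat n_p\rangle_{\hat\Gamma}+\langle R_5,\hat P_p(\hat\zeta)\rangle_{\hat\Gamma},$$ $$A_d(\hat\psi)+L_3\langle\hat\phi_r,\hat\psi\rangle_{\hat\Gamma}-\langle\hat\xi_r\cdot\hat n_p,\hat\psi\rangle_{\hat\Gamma}=(\hat F_d,\hat\psi)_p+\langle R_4,\hat\psi\rangle_{\hat\Gamma},$$ where $A_f,A_s,A_d$ are formed with $(u_r,p_r,\hat\eta_r,\hat\xi_r,\hat\phi_r)$.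 **Theorem (Equivalency).** Assume that the coupled problem has at most one solution. Let $(u,p,\hat\eta,\hat\xi,\hat\phi)$ be the solution of the coupled problem and let $(u_r,p_r,\hat\eta_r,\hat\xi_r,\hat\phi_r)$ be a solution of the decoupled problem. Then $(u,p,\hat\eta,\hat\xi,\hat\phi)=(u_r,p_r,\hat\eta_r,\hat\xi_r,\hat\phi_r)$ if and only if, for a.e. $t\in(0,T)$, $$R_1=L_1u_r\cdot n_f-\phi_r,\quad R_2=\gamma P_f(\xi_r)\quad\text{a.e. on }\Gamma(t),$$ $$R_3=L_2\hat\xi_r\cdot\hat n_p,\quad R_4=L_3\hat\phi_r-\hat u_r\cdot\hat n_p,\quad R_5=\gamma\hat P_p(\hat u_r)\quad\text{a.e. on }\hat\Gamma .$$ -/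

import Mathlib

open MeasureTheory Set Filter Topology
open scoped ContDiff

noncomputable section

namespace NSBiot

/-- Euclidean space `ℝ^d`. -/
abbrev E (d : ℕ) := EuclideanSpace ℝ (Fin d)

variable {d : ℕ}

/-! ### Domains, surface measure, outward normals -/

/-- A bounded open set with Lipschitz boundary: near each boundary point, `Ω` is the set of points
lying below the graph of a Lipschitz function over a hyperplane `ν^⊥`. -/
structure IsLipschitzDomain (Ω : Set (E d)) : Prop where
  isOpen : IsOpen Ω
  isBounded : Bornology.IsBounded Ω
  locallyGraph : ∀ x ∈ frontier Ω, ∃ (ν : E d) (h : E d → ℝ) (C : NNReal) (r : ℝ),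
    ‖ν‖ = 1 ∧ LipschitzWith C h ∧ 0 < r ∧
      ∀ y ∈ Metric.ball x r, y ∈ Ω ↔ inner ℝ y ν < h (y - (inner ℝ y ν : ℝ) • ν)

/-- Surface measure on `S`: the `(d-1)`-dimensional Hausdorff measure, normalised so that it agrees
with Lebesgue measure on hyperplanes. -/
def surf (S : Set (E d)) : Measure (E d) :=
  (Measure.euclideanHausdorffMeasure (d - 1)).restrict S

/-- `ν` is the outward unit normal of `Ω` at `x`: to first order at `x`, `Ω` coincides with the
half-space `{y | (y - x) · ν < 0}`. (For a Lipschitz domain this holds at every boundary point at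
which the graph function is differentiable, hence at almost every boundary point.) -/
def IsOuterNormal (Ω : Set (E d)) (x ν : E d) : Prop :=
  ‖ν‖ = 1 ∧ ∀ ε > 0, ∃ r > 0, ∀ y ∈ Metric.ball x r,
    ((inner ℝ (y - x) ν : ℝ) < -ε * ‖y - x‖ → y ∈ Ω) ∧
    (ε * ‖y - x‖ < (inner ℝ (y - x) ν : ℝ) → y ∉ Ω)

open Classical in
/-- The outward unit normal field of `Ω` (zero where there is none). -/
def outerNormal (Ω : Set (E d)) (x : E d) : E d :=
  if h : ∃ ν, IsOuterNormal Ω x ν then h.choose else 0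

/-- Orthogonal projection onto the tangent space `n^⊥`, i.e. `a ↦ ∑ⱼ (a · τⱼ) τⱼ` for any
orthonormal basis `τⱼ` of `n^⊥`. -/
def tangProj (n a : E d) : E d := (Submodule.span ℝ {n})ᗮ.starProjection a

/-! ### Sobolev spaces and traces -/

/-- `g` is the weak partial derivative `∂ⱼ f` in the open set `Ω`. -/
def HasWeakPartial (Ω : Set (E d)) (j : Fin d) (f g : E d → ℝ) : Prop :=
  ∀ θ : E d → ℝ, ContDiff ℝ ∞ θ → HasCompactSupport θ → tsupport θ ⊆ Ω →
    ∫ x in Ω, f x * fderiv ℝ θ x (EuclideanSpace.single j 1) = - ∫ x in Ω, g x * θ x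

/-- `f ∈ H¹(Ω)`. -/
def MemH1 (Ω : Set (E d)) (f : E d → ℝ) : Prop :=
  MemLp f 2 (volume.restrict Ω) ∧
    ∀ j, ∃ g, MemLp g 2 (volume.restrict Ω) ∧ HasWeakPartial Ω j f g

open Classical in
/-- The weak partial derivative `∂ⱼ f ∈ L²(Ω)` (unique almost everywhere in `Ω`). -/
def weakPartial (Ω : Set (E d)) (j : Fin d) (f : E d → ℝ) : E d → ℝ :=
  if h : ∃ g, MemLp g 2 (volume.restrict Ω) ∧ HasWeakPartial Ω j f g then h.choose else 0

/-- `g` is the trace of `f` on `∂Ω`: `g ∈ L²(∂Ω)`, and at almost every boundary point `x` the mean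
value of `|f - g x|` over `Ω ∩ B(x, r)` tends to `0` as `r → 0`. -/
def HasTrace {F : Type*} [NormedAddCommGroup F] (Ω : Set (E d)) (f g : E d → F) : Prop :=
  MemLp g 2 (surf (frontier Ω)) ∧
    ∀ᵐ x ∂(surf (frontier Ω)),
      Tendsto (fun r : ℝ => ⨍ y in Metric.ball x r ∩ Ω, ‖f y - g x‖) (𝓝[>] 0) (𝓝 0)

open Classical in
/-- The trace of `f` on `∂Ω` (unique almost everywhere on `∂Ω`). -/
def trace {F : Type*} [NormedAddCommGroup F] (Ω : Set (E d)) (f : E d → F) : E d → F :=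
  if h : ∃ g, HasTrace Ω f g then h.choose else 0

/-- `f` has a trace, and the trace vanishes almost everywhere on the boundary part `S`. -/
def TraceZeroOn {F : Type*} [NormedAddCommGroup F] (Ω S : Set (E d)) (f : E d → F) : Prop :=
  HasTrace Ω f (trace Ω f) ∧ ∀ᵐ x ∂(surf S), trace Ω f x = 0

/-- `{f ∈ H¹(Ω) : f = 0 on S}`. -/
def MemScalarSpace (Ω S : Set (E d)) (f : E d → ℝ) : Prop :=
  MemH1 Ω f ∧ TraceZeroOn Ω S f

/-- `{v ∈ H¹(Ω)^d : v = 0 on S}`. -/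
def MemVectorSpace (Ω S : Set (E d)) (v : E d → E d) : Prop :=
  (∀ i, MemH1 Ω (fun x => v x i)) ∧ TraceZeroOn Ω S v

/-- Weak gradient of a scalar function. -/
def grad (Ω : Set (E d)) (f : E d → ℝ) (x : E d) : E d :=
  WithLp.toLp 2 fun j => weakPartial Ω j f x

/-- Weak Jacobian matrix of a vector field, with entries `∂ⱼ vᵢ`. -/
def jac (Ω : Set (E d)) (v : E d → E d) (x : E d) : Matrix (Fin d) (Fin d) ℝ :=
  Matrix.of fun i j => weakPartial Ω j (fun y => v y i) x

/-- Weak divergence. -/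
def div (Ω : Set (E d)) (v : E d → E d) (x : E d) : ℝ := (jac Ω v x).trace

/-- Symmetric gradient `𝔻(v) = (∇v + ∇vᵀ)/2`. -/
def symGrad (Ω : Set (E d)) (v : E d → E d) (x : E d) : Matrix (Fin d) (Fin d) ℝ :=
  (1 / 2 : ℝ) • (jac Ω v x + (jac Ω v x).transpose)

/-- The `L²` pairing of two scalar or vector fields with respect to `μ`. -/
def pair {F : Type*} [NormedAddCommGroup F] [InnerProductSpace ℝ F]
    (μ : Measure (E d)) (f g : E d → F) : ℝ := ∫ x, inner ℝ (f x) (g x) ∂μ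

/-- `(𝔻(u), 𝔻(v))` over `Ω`. -/
def strainPair (Ω : Set (E d)) (u v : E d → E d) : ℝ :=
  ∫ x in Ω, ∑ i, ∑ j, symGrad Ω u x i j * symGrad Ω v x i j

/-- The convective derivative `a · ∇u`. -/
def convect (Ω : Set (E d)) (a u : E d → E d) (x : E d) : E d :=
  WithLp.toLp 2 ((jac Ω u x).mulVec (WithLp.ofLp (a x)))

/-- Normal component of the vector field `v` along `n`. -/
def nrm (n v : E d → E d) (x : E d) : ℝ := inner ℝ (v x) (n x)

/-- Tangential part of the vector field `v` on a surface with normal `n`. -/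
def tan (n v : E d → E d) (x : E d) : E d := tangProj (n x) (v x)

/-- The curve `f` belongs to `H¹(0, T; X)`. -/
def MemH1Time {X : Type*} [NormedAddCommGroup X] [NormedSpace ℝ X] (T : ℝ) (f : ℝ → X) : Prop :=
  ∃ f' : ℝ → X, MemLp f' 2 (volume.restrict (Ioo 0 T)) ∧
    ∀ t ∈ Icc 0 T, f t = f 0 + ∫ s in (0 : ℝ)..t, f' s

/-- `f ∈ L²(0, T; L²(S(t)))` for a family of surfaces `S(t)`. -/
def MemL2Surf {F : Type*} [NormedAddCommGroup F] (T : ℝ) (S : ℝ → Set (E d))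
    (f : ℝ → E d → F) : Prop :=
  (∀ᵐ t ∂(volume.restrict (Ioo 0 T)), MemLp (f t) 2 (surf (S t))) ∧
    ∫⁻ t in Ioo 0 T, (eLpNorm (f t) 2 (surf (S t))) ^ 2 < ⊤

/-! ### Reference configuration, parameters, data -/

/-- `A`, `B`, `C` are pairwise disjoint relatively open parts of `∂Ω` that cover `∂Ω` up to a
surface null set. -/
structure IsBoundaryPartition (Ω A B C : Set (E d)) : Prop where
  relOpenA : ∃ U, IsOpen U ∧ U ∩ frontier Ω = A
  relOpenB : ∃ U, IsOpen U ∧ U ∩ frontier Ω = B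
  relOpenC : ∃ U, IsOpen U ∧ U ∩ frontier Ω = C
  disjAB : Disjoint A B
  disjAC : Disjoint A C
  disjBC : Disjoint B C
  cover : surf (frontier Ω) (A ∪ B ∪ C)ᶜ = 0

/-- The reference configuration: the fluid domain `Ωf`, the poroelastic domain `Ωp`, the interface
`Γ`, and the Dirichlet and Neumann parts of the external boundaries. -/
structure Geometry (d : ℕ) where
  Ωf : Set (E d)
  Ωp : Set (E d)
  Γ : Set (E d)
  SfD : Set (E d)
  SfN : Set (E d)
  SpD : Set (E d)
  SpN : Set (E d)
  lipf : IsLipschitzDomain Ωf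
  lipp : IsLipschitzDomain Ωp
  disj : Disjoint Ωf Ωp
  partf : IsBoundaryPartition Ωf Γ SfD SfN
  partp : IsBoundaryPartition Ωp Γ SpD SpN

/-- Physical parameters; `K` is the uniformly bounded and elliptic conductivity tensor. -/
structure Params (G : Geometry d) where
  ρf : ℝ
  μf : ℝ
  ρp : ℝ
  μp : ℝ
  lamp : ℝ
  α : ℝ
  C0 : ℝ
  γ : ℝ
  γ_pos : 0 < γ
  K : E d → E d →L[ℝ] E d
  K_meas : AEStronglyMeasurable K (volume.restrict G.Ωp)
  K_elliptic : ∃ Km KM : ℝ, 0 < Km ∧ 0 < KM ∧ ∀ x ∈ G.Ωp, ∀ z : E d,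
    Km * ‖z‖ ^ 2 ≤ inner ℝ z (K x z) ∧ ‖K x z‖ ≤ KM * ‖z‖

/-- Forcing terms and initial values. -/
structure Data (G : Geometry d) (T : ℝ) where
  Ff : ℝ → E d → E d
  g : ℝ → E d → E d
  Fd : ℝ → E d → ℝ
  u0 : Lp (E d) 2 (volume.restrict G.Ωf)
  η0 : E d → E d
  ξ0 : Lp (E d) 2 (volume.restrict G.Ωp)
  φ0 : Lp ℝ 2 (volume.restrict G.Ωp)
  Ff_mem : ∀ᵐ t ∂(volume.restrict (Ioo 0 T)), ∀ B : Set (E d), IsCompact B →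
    MemLp (Ff t) 2 (volume.restrict B)
  g_mem : ∀ᵐ t ∂(volume.restrict (Ioo 0 T)), MemLp (g t) 2 (surf G.SfN)
  Fd_mem : ∀ᵐ t ∂(volume.restrict (Ioo 0 T)), MemLp (Fd t) 2 (volume.restrict G.Ωp)

/-! ### Moving domain -/

/-- `f ∘ Φ⁻¹`, where `Φ` is invertible on the closure of `Ω`. -/
def push {F : Type*} (Φ : E d → E d) (Ω : Set (E d)) (f : E d → F) : E d → F :=
  f ∘ Function.invFunOn Φ (closure Ω)

/-- `ηf` is the `C^k` displacement of the fluid domain obtained by harmonic extension of the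
interface values of the structure displacement `η`. -/
structure IsALEDisp (G : Geometry d) (k : ℕ∞) (T : ℝ) (η ηf : ℝ → E d → E d) : Prop where
  smooth : ContDiff ℝ k (fun z : ℝ × E d => ηf z.1 z.2)
  harmonic : ∀ t ∈ Icc 0 T, InnerProductSpace.HarmonicOnNhd (ηf t) G.Ωf
  onInterface : ∀ t ∈ Icc 0 T, ∀ x ∈ G.Γ, ηf t x = η t x
  onOuter : ∀ t ∈ Icc 0 T, ∀ x ∈ frontier G.Ωf \ G.Γ, ηf t x = 0

open Classical in
/-- The harmonic extension of the interface displacement (unique on `[0,T] × closure Ωf`). -/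
def aleDisp (G : Geometry d) (k : ℕ∞) (T : ℝ) (η : ℝ → E d → E d) : ℝ → E d → E d :=
  if h : ∃ ηf, IsALEDisp G k T η ηf then h.choose else 0

/-- The Lagrangian map `Φ_p`. -/
def lagMap (η : ℝ → E d → E d) (t : ℝ) (x : E d) : E d := x + η t x

/-- The ALE map `Φ_f`. -/
def aleMap (G : Geometry d) (k : ℕ∞) (T : ℝ) (η : ℝ → E d → E d) (t : ℝ) (x : E d) : E d :=
  x + aleDisp G k T η t x

/-- `Φ` is invertible on the closure of `Ω`, with invertible derivative. -/
def IsInvertibleOn (Ω : Set (E d)) (Φ : E d → E d) : Prop :=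
  InjOn Φ (closure Ω) ∧ ∀ x ∈ closure Ω, (fderiv ℝ Φ x).det ≠ 0

/-- The unknowns. The Eulerian fluid velocity and pressure on `Ω_f(t)` are represented by their
ALE counterparts `u ∘ Φ_f` and `p ∘ Φ_f` on the reference domain. -/
structure State (G : Geometry d) where
  u : ℝ → Lp (E d) 2 (volume.restrict G.Ωf)
  p : ℝ → Lp ℝ 2 (volume.restrict G.Ωf)
  η : ℝ → E d → E d
  ξ : ℝ → Lp (E d) 2 (volume.restrict G.Ωp)
  φ : ℝ → Lp ℝ 2 (volume.restrict G.Ωp)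

/-- Two quintuples agree on the time interval. -/
structure State.Same {G : Geometry d} (T : ℝ) (S S' : State G) : Prop where
  u : ∀ t ∈ Icc 0 T, S.u t = S'.u t
  p : ∀ᵐ t ∂(volume.restrict (Ioo 0 T)), S.p t = S'.p t
  η : ∀ t ∈ Icc 0 T, ∀ x ∈ G.Ωp, S.η t x = S'.η t x
  ξ : ∀ t ∈ Icc 0 T, S.ξ t = S'.ξ t
  φ : ∀ t ∈ Icc 0 T, S.φ t = S'.φ t

section Moving

variable {G : Geometry d} (k : ℕ∞) (T : ℝ) (S : State G) (t : ℝ)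

/-- The ALE map of a state at time `t`. -/
def State.Φf : E d → E d := aleMap G k T S.η t

/-- The Lagrangian map of a state at time `t`. -/
def State.Φp : E d → E d := lagMap S.η t

/-- The current fluid domain `Ω_f(t)`. -/
def State.Ωf : Set (E d) := S.Φf k T t '' G.Ωf

/-- The current interface `Γ(t)`. -/
def State.Γ : Set (E d) := S.Φf k T t '' G.Γ

/-- The current Neumann boundary `Σ_f^N(t)`. -/
def State.SfN : Set (E d) := S.Φf k T t '' G.SfN

/-- Push-forward `f ∘ (Φ_f)⁻¹` of a field from the reference to the current fluid domain. -/
def State.pushf {F : Type*} (f : E d → F) : E d → F := push (S.Φf k T t) G.Ωf f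

/-- Push-forward `f ∘ (Φ_p)⁻¹` of a field from the reference to the current structure domain. -/
def State.pushp {F : Type*} (f : E d → F) : E d → F := push (S.Φp t) G.Ωp f

/-- The Eulerian fluid velocity on `Ω_f(t)`. -/
def State.uE : E d → E d := S.pushf k T t (S.u t)

/-- The Eulerian fluid pressure on `Ω_f(t)`. -/
def State.pE : E d → ℝ := S.pushf k T t (S.p t)

/-- The ALE time derivative `∂u/∂t` at fixed reference position, as a function on `Ω_f(t)`. -/
def State.dtuE : E d → E d := S.pushf k T t (deriv S.u t : Lp (E d) 2 (volume.restrict G.Ωf))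

/-- The domain velocity on `Ω_f(t)`. -/
def State.wE : E d → E d :=
  S.pushf k T t fun x => deriv (fun s => aleDisp G k T S.η s x) t

/-- The outward unit normal of `Ω_f(t)`. -/
def State.nf : E d → E d := outerNormal (S.Ωf k T t)

/-- Trace of the fluid velocity on the reference interface. -/
def State.uRef : E d → E d := trace G.Ωf (S.u t)

/-- Trace of the structure velocity on the reference interface. -/
def State.ξRef : E d → E d := trace G.Ωp (S.ξ t)

/-- Trace of the pore pressure on the reference interface. -/
def State.φRef : E d → ℝ := trace G.Ωp (S.φ t)

/-- Trace of the fluid velocity on the current interface. -/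
def State.uCur : E d → E d := S.pushf k T t (S.uRef t)

/-- Trace of the structure velocity on the current interface. -/
def State.ξCur : E d → E d := S.pushp t (S.ξRef t)

/-- Trace of the pore pressure on the current interface. -/
def State.φCur : E d → ℝ := S.pushp t (S.φRef t)

end Moving

/-- The outward unit normal of the reference poroelastic domain. -/
def Geometry.np (G : Geometry d) : E d → E d := outerNormal G.Ωp

/-- Regularity, boundary and initial conditions that are common to the coupled and the decoupled
problem. -/
structure IsAdmissible {G : Geometry d} {T : ℝ} (D : Data G T) (k : ℕ∞) (S : State G) :
    Prop where
  smooth_η : ContDiff ℝ k (fun z : ℝ × E d => S.η z.1 z.2)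
  invertible_Φp : ∀ t ∈ Icc 0 T, IsInvertibleOn G.Ωp (S.Φp t)
  ale : IsALEDisp G k T S.η (aleDisp G k T S.η)
  invertible_Φf : ∀ t ∈ Icc 0 T, IsInvertibleOn G.Ωf (S.Φf k T t)
  velocity : ∀ t ∈ Ioo 0 T,
    S.ξ t =ᵐ[volume.restrict G.Ωp] fun x => deriv (fun s => S.η s x) t
  time_u : MemH1Time T S.u
  time_ξ : MemH1Time T S.ξ
  time_φ : MemH1Time T S.φ
  mem_u : ∀ᵐ t ∂(volume.restrict (Ioo 0 T)), MemVectorSpace G.Ωf G.SfD (S.u t)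
  mem_η : ∀ᵐ t ∂(volume.restrict (Ioo 0 T)), MemVectorSpace G.Ωp G.SpD (S.η t)
  mem_ξ : ∀ᵐ t ∂(volume.restrict (Ioo 0 T)), MemVectorSpace G.Ωp G.SpD (S.ξ t)
  mem_φ : ∀ᵐ t ∂(volume.restrict (Ioo 0 T)), MemScalarSpace G.Ωp G.SpD (S.φ t)
  init_u : S.u 0 = D.u0
  init_η : ∀ x ∈ G.Ωp, S.η 0 x = D.η0 x
  init_ξ : S.ξ 0 = D.ξ0
  init_φ : S.φ 0 = D.φ0

/-! ### Weak formulations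

Test functions on `Ω_f(t)` are `v ∘ Φ_f⁻¹`, `q ∘ Φ_f⁻¹` with `v`, `q` on the reference domain. -/

section Forms

variable {G : Geometry d} (P : Params G) (k : ℕ∞) (T : ℝ) (S : State G) (t : ℝ)

/-- `ρ_f (∂ₜu, v)_f + ρ_f ((u - w)·∇u, v)_f + 2 μ_f (𝔻(u), 𝔻(v))_f - (p, ∇·v)_f`. -/
def fluidForm (v : E d → E d) : ℝ :=
  let Ω := S.Ωf k T t;
  let V := S.pushf k T t v;
  P.ρf * (pair (volume.restrict Ω) (S.dtuE k T t) V
      + pair (volume.restrict Ω)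
          (convect Ω (fun x => S.uE k T t x - S.wE k T t x) (S.uE k T t)) V)
    + 2 * P.μf * strainPair Ω (S.uE k T t) V
    - pair (volume.restrict Ω) (S.pE k T t) (div Ω V)

/-- `(∇·u, q)_f`. -/
def incompForm (q : E d → ℝ) : ℝ :=
  pair (volume.restrict (S.Ωf k T t)) (div (S.Ωf k T t) (S.uE k T t)) (S.pushf k T t q)

/-- `(F_f, v)_f + ⟨g, v⟩_{Σ_f^N}`. -/
def fluidLoad (D : Data G T) (v : E d → E d) : ℝ :=
  pair (volume.restrict (S.Ωf k T t)) (D.Ff t) (S.pushf k T t v)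
    + pair (surf (S.SfN k T t)) (D.g t) (S.pushf k T t (trace G.Ωf v))

/-- `ρ_p (∂ₜξ, ζ)_p + 2 μ_p (𝔻(η), 𝔻(ζ))_p + λ_p (∇·η, ∇·ζ)_p - α (φ, ∇·ζ)_p`. -/
def structForm (ζ : E d → E d) : ℝ :=
  P.ρp * pair (volume.restrict G.Ωp) (deriv S.ξ t : Lp (E d) 2 (volume.restrict G.Ωp)) ζ
    + 2 * P.μp * strainPair G.Ωp (S.η t) ζ
    + P.lamp * pair (volume.restrict G.Ωp) (div G.Ωp (S.η t)) (div G.Ωp ζ)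
    - P.α * pair (volume.restrict G.Ωp) (S.φ t) (div G.Ωp ζ)

/-- `C₀ (∂ₜφ, ψ)_p + α (∇·ξ, ψ)_p + (K∇φ, ∇ψ)_p`. -/
def poreForm (ψ : E d → ℝ) : ℝ :=
  P.C0 * pair (volume.restrict G.Ωp) (deriv S.φ t : Lp ℝ 2 (volume.restrict G.Ωp)) ψ
    + P.α * pair (volume.restrict G.Ωp) (div G.Ωp (S.ξ t)) ψ
    + pair (volume.restrict G.Ωp) (fun x => P.K x (grad G.Ωp (S.φ t) x)) (grad G.Ωp ψ)

/-- `(F_d, ψ)_p`. -/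
def poreLoad (D : Data G T) (ψ : E d → ℝ) : ℝ := pair (volume.restrict G.Ωp) (D.Fd t) ψ

/-- Coupled interface terms on `Γ(t)`: `⟨φ, v·n_f⟩ + γ ⟨P_f(u - ξ), P_f(v)⟩`. -/
def coupledFluidInterface (v : E d → E d) : ℝ :=
  let n := S.nf k T t;
  let V := S.pushf k T t (trace G.Ωf v);
  pair (surf (S.Γ k T t)) (S.φCur t) (nrm n V)
    + P.γ * pair (surf (S.Γ k T t)) (tan n fun x => S.uCur k T t x - S.ξCur t x) (tan n V)

/-- Coupled interface terms on the reference interface: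
`⟨φ, ζ·n_p⟩ - γ ⟨P_p(u - ξ), P_p(ζ)⟩ - ⟨(ξ - u)·n_p, ψ⟩`. -/
def coupledBiotInterface (ζ : E d → E d) (ψ : E d → ℝ) : ℝ :=
  let n := G.np;
  let Z := trace G.Ωp ζ;
  let Ψ := trace G.Ωp ψ;
  pair (surf G.Γ) (S.φRef t) (nrm n Z)
    - P.γ * pair (surf G.Γ) (tan n fun x => S.uRef t x - S.ξRef t x) (tan n Z)
    - pair (surf G.Γ) (nrm n fun x => S.ξRef t x - S.uRef t x) Ψ

/-- `S` is a solution of the coupled weak formulation. -/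
structure IsCoupledSolution (D : Data G T) : Prop where
  admissible : IsAdmissible D k S
  weak : ∀ᵐ t ∂(volume.restrict (Ioo 0 T)), ∀ (v : E d → E d) (q : E d → ℝ)
    (ζ : E d → E d) (ψ : E d → ℝ),
    MemVectorSpace G.Ωf G.SfD v → MemLp q 2 (volume.restrict G.Ωf) →
    MemVectorSpace G.Ωp G.SpD ζ → MemScalarSpace G.Ωp G.SpD ψ →
    fluidForm P k T S t v + incompForm k T S t q + coupledFluidInterface P k T S t v
      + structForm P S t ζ + poreForm P S t ψ + coupledBiotInterface P S t ζ ψ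
      = fluidLoad k T S t D v + poreLoad T t D ψ

end Forms

/-- Right-hand sides of the Robin conditions: `R1`, `R2` on `Γ(t)` and `R3`, `R4`, `R5` on the
reference interface. -/
structure RobinData (d : ℕ) where
  R1 : ℝ → E d → ℝ
  R2 : ℝ → E d → E d
  R3 : ℝ → E d → ℝ
  R4 : ℝ → E d → ℝ
  R5 : ℝ → E d → E d

section Robin

variable {G : Geometry d} (P : Params G) (k : ℕ∞) (T : ℝ) (S : State G) (L1 L2 L3 : ℝ)
  (R : RobinData d)

/-- The Robin data are square integrable on the interfaces belonging to `S`, and the data `R2`, `R5`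
of the tangential conditions are tangential. -/
structure IsRobinData : Prop where
  mem1 : MemL2Surf T (fun t => S.Γ k T t) R.R1
  mem2 : MemL2Surf T (fun t => S.Γ k T t) R.R2
  mem3 : MemL2Surf T (fun _ => G.Γ) R.R3
  mem4 : MemL2Surf T (fun _ => G.Γ) R.R4
  mem5 : MemL2Surf T (fun _ => G.Γ) R.R5
  tangential2 : ∀ᵐ t ∂(volume.restrict (Ioo 0 T)), ∀ᵐ x ∂(surf (S.Γ k T t)),
    tangProj (S.nf k T t x) (R.R2 t x) = R.R2 t x
  tangential5 : ∀ᵐ t ∂(volume.restrict (Ioo 0 T)), ∀ᵐ x ∂(surf G.Γ),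
    tangProj (G.np x) (R.R5 t x) = R.R5 t x

/-- `S` is a solution of the decoupled fluid and Biot problems with Robin conditions. -/
structure IsDecoupledSolution (D : Data G T) : Prop where
  admissible : IsAdmissible D k S
  momentum : ∀ᵐ t ∂(volume.restrict (Ioo 0 T)), ∀ v : E d → E d,
    MemVectorSpace G.Ωf G.SfD v →
    fluidForm P k T S t v
      + L1 * pair (surf (S.Γ k T t)) (nrm (S.nf k T t) (S.uCur k T t))
          (nrm (S.nf k T t) (S.pushf k T t (trace G.Ωf v)))
      + P.γ * pair (surf (S.Γ k T t)) (tan (S.nf k T t) (S.uCur k T t))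
          (tan (S.nf k T t) (S.pushf k T t (trace G.Ωf v)))
      = fluidLoad k T S t D v
        + pair (surf (S.Γ k T t)) (R.R2 t)
            (tan (S.nf k T t) (S.pushf k T t (trace G.Ωf v)))
        + pair (surf (S.Γ k T t)) (R.R1 t)
            (nrm (S.nf k T t) (S.pushf k T t (trace G.Ωf v)))
  incompressible : ∀ᵐ t ∂(volume.restrict (Ioo 0 T)), ∀ q : E d → ℝ,
    MemLp q 2 (volume.restrict G.Ωf) → incompForm k T S t q = 0
  structure_eq : ∀ᵐ t ∂(volume.restrict (Ioo 0 T)), ∀ ζ : E d → E d,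
    MemVectorSpace G.Ωp G.SpD ζ →
    structForm P S t ζ
      + P.γ * pair (surf G.Γ) (tan G.np (S.ξRef t)) (tan G.np (trace G.Ωp ζ))
      + pair (surf G.Γ) (fun x => S.φRef t x + L2 * nrm G.np (S.ξRef t) x)
          (nrm G.np (trace G.Ωp ζ))
      = pair (surf G.Γ) (R.R3 t) (nrm G.np (trace G.Ωp ζ))
        + pair (surf G.Γ) (R.R5 t) (tan G.np (trace G.Ωp ζ))
  pore_eq : ∀ᵐ t ∂(volume.restrict (Ioo 0 T)), ∀ ψ : E d → ℝ,
    MemScalarSpace G.Ωp G.SpD ψ →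
    poreForm P S t ψ
      + L3 * pair (surf G.Γ) (S.φRef t) (trace G.Ωp ψ)
      - pair (surf G.Γ) (nrm G.np (S.ξRef t)) (trace G.Ωp ψ)
      = poreLoad T t D ψ + pair (surf G.Γ) (R.R4 t) (trace G.Ωp ψ)

/-- The compatibility conditions between the Robin data and the state. -/
structure IsCompatible : Prop where
  c1 : ∀ᵐ t ∂(volume.restrict (Ioo 0 T)), ∀ᵐ x ∂(surf (S.Γ k T t)),
    R.R1 t x = L1 * nrm (S.nf k T t) (S.uCur k T t) x - S.φCur t x
  c2 : ∀ᵐ t ∂(volume.restrict (Ioo 0 T)), ∀ᵐ x ∂(surf (S.Γ k T t)),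
    R.R2 t x = P.γ • tan (S.nf k T t) (S.ξCur t) x
  c3 : ∀ᵐ t ∂(volume.restrict (Ioo 0 T)), ∀ᵐ x ∂(surf G.Γ),
    R.R3 t x = L2 * nrm G.np (S.ξRef t) x
  c4 : ∀ᵐ t ∂(volume.restrict (Ioo 0 T)), ∀ᵐ x ∂(surf G.Γ),
    R.R4 t x = L3 * S.φRef t x - nrm G.np (S.uRef t) x
  c5 : ∀ᵐ t ∂(volume.restrict (Ioo 0 T)), ∀ᵐ x ∂(surf G.Γ),
    R.R5 t x = P.γ • tan G.np (S.uRef t) x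

end Robin

end NSBiot

end

/-!
At a solution of the decoupled problem, adding the fluid, structure and pore-pressure equations
reproduces the coupled equation up to interface terms, and these terms are exactly the `L²` pairings
of the traces of the test functions with the defects of the compatibility conditions for `R1, …, R5`
(`IsDecoupledSolution.coupled_eq_add_defect`). So a decoupled solution solves the coupled problem if
and only if all defects vanish (`IsDecoupledSolution.isCoupledSolution_iff`). With uniqueness for
the coupled problem, compatible data force the two solutions to agree.

Vanishing of the defects uses the fundamental lemma of the calculus of variations on the interface
(`ae_eq_zero_of_pair_nrm_add_pair_tan`, `ae_eq_zero_of_pair_trace`), tested with smooth functions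
supported in an open set that meets the boundary only in the interface. These are admissible because
the boundary of a Lipschitz domain has finite surface measure and the trace of a smooth function is
its restriction. To split a vector field into its normal and tangential part one needs a unit normal
almost everywhere. On the reference interface it comes from Rademacher's theorem; on `Γ(t)` one
transports first-order defining functions by the `C¹` map `Φ_f`
(`ae_exists_isOuterNormal_image`). The normal field is Borel for any set, since its graph is
(`measurable_outerNormal`), and `L²` fields on the reference interface push forward to `L²` fields
on `Γ(t)` because `Φ_f` is Lipschitz (`memLp_push`); so all pairings are integrals of integrable
functions.

Conversely, if the two solutions agree on the time interval, then the decoupled one solves the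
coupled problem (`State.Same.isCoupledSolution`). Here agreement of the structure displacements on
`Ω_p` has to give the same ALE map on the closure of `Ω_f`, which is uniqueness of the harmonic
extension, by the maximum principle (`IsALEDisp.eqOn_closure`).
-/

namespace NSBiot

variable {d : ℕ}

/-! ### Outward normals and tangential projections -/

theorem IsOuterNormal.unique {Ω : Set (E d)} {x ν ν' : E d} (h : IsOuterNormal Ω x ν)
    (h' : IsOuterNormal Ω x ν') : ν = ν' := by
  by_contra hne
  -- In the direction `ν' - ν` the two half-spaces contradict each other.
  have he : 0 < ‖ν' - ν‖ := norm_pos_iff.2 (sub_ne_zero.2 (Ne.symm hne))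
  have hsq : ‖ν' - ν‖ ^ 2 = 2 - 2 * inner ℝ ν' ν := by
    rw [norm_sub_sq_real, h.1, h'.1]; ring
  have h1 : inner ℝ (ν' - ν) ν = -‖ν' - ν‖ ^ 2 / 2 := by
    rw [hsq, inner_sub_left, real_inner_self_eq_norm_sq, h.1]; ring
  have h2 : inner ℝ (ν' - ν) ν' = ‖ν' - ν‖ ^ 2 / 2 := by
    rw [hsq, inner_sub_left, real_inner_self_eq_norm_sq, h'.1, real_inner_comm]; ring
  set e := ν' - ν
  obtain ⟨r, hr, H⟩ := h.2 (‖e‖ / 4) (by positivity)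
  obtain ⟨r', hr', H'⟩ := h'.2 (‖e‖ / 4) (by positivity)
  set s : ℝ := min r r' / (2 * ‖e‖)
  have hm : 0 < min r r' := lt_min hr hr'
  have hs : 0 < s := by positivity
  have hse : s * ‖e‖ = min r r' / 2 := by simp only [s]; field_simp
  have hd : dist (x + s • e) x = min r r' / 2 := by
    rw [dist_eq_norm, add_sub_cancel_left, norm_smul, Real.norm_of_nonneg hs.le, hse]
  have hpos : 0 < s * ‖e‖ ^ 2 := by positivity
  refine (H' (x + s • e) ?_).2 ?_ ((H (x + s • e) ?_).1 ?_)
  · rw [Metric.mem_ball, hd]; linarith [min_le_right r r']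
  · rw [add_sub_cancel_left, inner_smul_left, h2, norm_smul, Real.norm_of_nonneg hs.le]
    simp only [conj_trivial]; nlinarith
  · rw [Metric.mem_ball, hd]; linarith [min_le_left r r']
  · rw [add_sub_cancel_left, inner_smul_left, h1, norm_smul, Real.norm_of_nonneg hs.le]
    simp only [conj_trivial]; nlinarith

theorem isOuterNormal_outerNormal {Ω : Set (E d)} {x : E d} (h : ∃ ν, IsOuterNormal Ω x ν) :
    IsOuterNormal Ω x (outerNormal Ω x) := by
  rw [outerNormal, dif_pos h]; exact h.choose_spec

theorem norm_outerNormal {Ω : Set (E d)} {x : E d} (h : ∃ ν, IsOuterNormal Ω x ν) :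
    ‖outerNormal Ω x‖ = 1 := (isOuterNormal_outerNormal h).1

theorem norm_outerNormal_eq_one_or (Ω : Set (E d)) (x : E d) :
    ‖outerNormal Ω x‖ = 1 ∨ outerNormal Ω x = 0 := by
  by_cases h : ∃ ν, IsOuterNormal Ω x ν
  · exact Or.inl (norm_outerNormal h)
  · right; rw [outerNormal, dif_neg h]

theorem norm_outerNormal_le (Ω : Set (E d)) (x : E d) : ‖outerNormal Ω x‖ ≤ 1 := by
  rcases norm_outerNormal_eq_one_or Ω x with h | h <;> simp [h]

/-- For fixed tolerance and radius the defining condition of an outward normal is closed in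
`(x, ν)`, whatever the set `Ω` is. Hence the graph of the normal field is Borel. -/
theorem measurableSet_isOuterNormal (Ω : Set (E d)) :
    MeasurableSet {z : E d × E d | IsOuterNormal Ω z.1 z.2} := by
  let C : ℕ → ℕ → Set (E d × E d) := fun n m => {z | ∀ y, dist y z.1 < 1 / ((m : ℝ) + 1) →
    ((inner ℝ (y - z.1) z.2 : ℝ) < -(1 / ((n : ℝ) + 1)) * ‖y - z.1‖ → y ∈ Ω) ∧
    ((1 / ((n : ℝ) + 1)) * ‖y - z.1‖ < (inner ℝ (y - z.1) z.2 : ℝ) → y ∉ Ω)}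
  have hC : ∀ n m, IsClosed (C n m) := by
    intro n m
    have : C n m = ⋂ y, {z : E d × E d | dist y z.1 < 1 / ((m : ℝ) + 1) →
      ((inner ℝ (y - z.1) z.2 : ℝ) < -(1 / ((n : ℝ) + 1)) * ‖y - z.1‖ → y ∈ Ω) ∧
      ((1 / ((n : ℝ) + 1)) * ‖y - z.1‖ < (inner ℝ (y - z.1) z.2 : ℝ) → y ∉ Ω)} := by
      ext z; simp [C]
    rw [this]
    refine isClosed_iInter fun y => ?_
    by_cases hy : y ∈ Ω
    · simp only [hy, implies_true, true_and, not_true_eq_false, imp_false]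
      exact isClosed_imp (isOpen_lt (continuous_const.dist continuous_fst) continuous_const)
        (isOpen_lt (f := fun z : E d × E d => 1 / ((n : ℝ) + 1) * ‖y - z.1‖)
          (g := fun z => inner ℝ (y - z.1) z.2) (by fun_prop) (by fun_prop)).isClosed_compl
    · simp only [hy, implies_true, and_true, not_false_eq_true, imp_false]
      exact isClosed_imp (isOpen_lt (continuous_const.dist continuous_fst) continuous_const)
        (isOpen_lt (f := fun z : E d × E d => inner ℝ (y - z.1) z.2)
          (g := fun z => -(1 / ((n : ℝ) + 1)) * ‖y - z.1‖)
          (by fun_prop) (by fun_prop)).isClosed_compl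
  have key : {z : E d × E d | IsOuterNormal Ω z.1 z.2}
      = {z | ‖z.2‖ = 1} ∩ ⋂ n, ⋃ m, C n m := by
    ext z
    simp only [mem_ofPred_eq, mem_inter_iff, mem_iInter, mem_iUnion, IsOuterNormal]
    refine and_congr_right fun _ => ⟨fun h n => ?_, fun h ε hε => ?_⟩
    · obtain ⟨r, hr, H⟩ := h (1 / ((n : ℝ) + 1)) (by positivity)
      obtain ⟨m, hm⟩ := exists_nat_one_div_lt hr
      exact ⟨m, fun y hy => H y (Metric.mem_ball.2 (hy.trans hm))⟩
    · obtain ⟨n, hn⟩ := exists_nat_one_div_lt hε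
      obtain ⟨m, hm⟩ := h n
      refine ⟨1 / ((m : ℝ) + 1), by positivity, fun y hy => ⟨fun hi => ?_, fun hi => ?_⟩⟩
      · exact (hm y hy).1 (hi.trans_le (by nlinarith [norm_nonneg (y - z.1)]))
      · exact (hm y hy).2 (lt_of_le_of_lt (by nlinarith [norm_nonneg (y - z.1)]) hi)
  rw [key]
  exact (isClosed_eq (by fun_prop) continuous_const).measurableSet.inter
    (MeasurableSet.iInter fun n => MeasurableSet.iUnion fun m => (hC n m).measurableSet)

/-- The normal field is Borel measurable: its graph is a Borel set with at most one point above
each `x`, so the Lusin–Souslin theorem applies to the projections. -/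
theorem measurable_outerNormal (Ω : Set (E d)) : Measurable (outerNormal Ω) := by
  set M := {z : E d × E d | IsOuterNormal Ω z.1 z.2}
  have hM : MeasurableSet M := measurableSet_isOuterNormal Ω
  have hinj : InjOn Prod.fst M := by
    rintro ⟨x, ν⟩ h ⟨x', ν'⟩ h' (rfl : x = x')
    exact congrArg (Prod.mk x) (IsOuterNormal.unique h h')
  intro B hB
  have key : outerNormal Ω ⁻¹' B = Prod.fst '' (M ∩ Prod.snd ⁻¹' B)
      ∪ ((Prod.fst '' M)ᶜ ∩ {_x | (0 : E d) ∈ B}) := by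
    ext x
    by_cases hx : ∃ ν, IsOuterNormal Ω x ν
    · have hx' : x ∈ Prod.fst '' M := ⟨(x, hx.choose), hx.choose_spec, rfl⟩
      have : x ∈ Prod.fst '' (M ∩ Prod.snd ⁻¹' B) ↔ outerNormal Ω x ∈ B := by
        constructor
        · rintro ⟨⟨x, ν⟩, ⟨h, hB⟩, rfl⟩
          rw [IsOuterNormal.unique (isOuterNormal_outerNormal hx) h]; exact hB
        · intro h
          exact ⟨(x, outerNormal Ω x), ⟨isOuterNormal_outerNormal hx, h⟩, rfl⟩
      rw [mem_union, this]
      simp [hx']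
    · have hx' : x ∉ Prod.fst '' M := by
        rintro ⟨⟨x, ν⟩, h, rfl⟩; exact hx ⟨ν, h⟩
      have hx'' : x ∉ Prod.fst '' (M ∩ Prod.snd ⁻¹' B) := fun h =>
        hx' (image_mono inter_subset_left h)
      rw [mem_union, mem_preimage, outerNormal, dif_neg hx]
      simp [hx', hx'']
  rw [key]
  exact ((hM.inter (measurable_snd hB)).image_of_measurable_injOn measurable_fst
    (hinj.mono inter_subset_left)).union
    ((hM.image_of_measurable_injOn measurable_fst hinj).compl.inter (MeasurableSet.const _))

theorem tangProj_eq {n : E d} (hn : ‖n‖ = 1 ∨ n = 0) (a : E d) :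
    tangProj n a = a - (inner ℝ a n : ℝ) • n := by
  rw [tangProj, Submodule.starProjection_orthogonal_val]
  rcases hn with hn | rfl
  · rw [Submodule.starProjection_unit_singleton ℝ hn, real_inner_comm]
  · simp

theorem tangProj_outerNormal (Ω : Set (E d)) (x a : E d) :
    tangProj (outerNormal Ω x) a
      = a - (inner ℝ a (outerNormal Ω x) : ℝ) • outerNormal Ω x :=
  tangProj_eq (norm_outerNormal_eq_one_or Ω x) a

theorem tangProj_sub (n a b : E d) : tangProj n (a - b) = tangProj n a - tangProj n b :=
  map_sub _ _ _

theorem tangProj_tangProj (n a : E d) : tangProj n (tangProj n a) = tangProj n a :=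
  Submodule.starProjection_eq_self_iff.2 (Submodule.starProjection_apply_mem _ _)

theorem inner_tangProj_right (n a b : E d) :
    (inner ℝ a (tangProj n b) : ℝ) = inner ℝ (tangProj n a) b :=
  (Submodule.inner_starProjection_left_eq_right _ a b).symm

theorem inner_tangProj_self (n a : E d) : (inner ℝ (tangProj n a) n : ℝ) = 0 := by
  have h : tangProj n a ∈ (Submodule.span ℝ {n})ᗮ := Submodule.starProjection_apply_mem _ _
  rw [real_inner_comm]
  exact h n (Submodule.mem_span_singleton_self n)

/-! ### First-order defining functions -/

/-- Near `x`, the set `Ω` is the strict sublevel set `{F < 0}` of a function `F` with `F x = 0`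
that is differentiable at `x` with nonzero derivative. -/
def HasDefiningFunction (Ω : Set (E d)) (x : E d) : Prop :=
  ∃ (F : E d → ℝ) (F' : E d →L[ℝ] ℝ), F' ≠ 0 ∧ HasFDerivAt F F' x ∧ F x = 0 ∧
    ∀ᶠ y in 𝓝 x, (y ∈ Ω ↔ F y < 0)

theorem HasDefiningFunction.exists_isOuterNormal {Ω : Set (E d)} {x : E d}
    (h : HasDefiningFunction Ω x) : ∃ ν, IsOuterNormal Ω x ν := by
  obtain ⟨F, F', hF', hF, hFx, hΩ⟩ := h
  set m := (InnerProductSpace.toDual ℝ (E d)).symm F' with hm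
  have hmF : ∀ w, F' w = inner ℝ w m := fun w => by
    rw [real_inner_comm, hm, InnerProductSpace.toDual_symm_apply]
  have hm0 : 0 < ‖m‖ := by
    rw [norm_pos_iff, hm]; simpa using hF'
  have hν : ∀ w, F' w = ‖m‖ * inner ℝ w (‖m‖⁻¹ • m) := fun w => by
    rw [hmF, inner_smul_right]; field_simp
  refine ⟨‖m‖⁻¹ • m, ?_, fun ε hε => ?_⟩
  · rw [norm_smul, norm_inv, norm_norm, inv_mul_cancel₀ hm0.ne']
  · have hlo := hF.isLittleO.def (c := ε * ‖m‖) (by positivity)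
    obtain ⟨r, hr, H⟩ := Metric.eventually_nhds_iff_ball.1 (hlo.and hΩ)
    refine ⟨r, hr, fun y hy => ?_⟩
    obtain ⟨h1, h2⟩ := H y hy
    rw [hFx, sub_zero, hν, Real.norm_eq_abs, abs_le] at h1
    refine ⟨fun hi => h2.2 ?_, fun hi hy => ?_⟩
    · nlinarith
    · have := h2.1 hy
      nlinarith

/-- Defining functions are transported by maps that are injective on the compact closure of `Ω` and
locally invertible at `x`: compose with the local inverse. Injectivity keeps the part of the image
coming from points away from `x` at a distance from `Φ x`. -/
theorem HasDefiningFunction.image {Ω : Set (E d)} {x : E d} {Φ : E d → E d}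
    (h : HasDefiningFunction Ω x) (hΩ : IsCompact (closure Ω)) (hΦ : ContDiff ℝ 1 Φ)
    (hinv : IsInvertibleOn Ω Φ) (hx : x ∈ closure Ω) : HasDefiningFunction (Φ '' Ω) (Φ x) := by
  obtain ⟨F, F', hF', hF, hFx, hFΩ⟩ := h
  set e := (fderiv ℝ Φ x).toContinuousLinearEquivOfDetNeZero (hinv.2 x hx) with he
  have hs : HasStrictFDerivAt Φ (e : E d →L[ℝ] E d) x := by
    rw [he, ContinuousLinearMap.coe_toContinuousLinearEquivOfDetNeZero]
    exact hΦ.contDiffAt.hasStrictFDerivAt one_ne_zero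
  set g := hs.localInverse Φ e x
  have hgx : g (Φ x) = x := hs.eventually_left_inverse.self_of_nhds
  have hg := hs.to_localInverse.hasFDerivAt
  have hgt : Tendsto g (𝓝 (Φ x)) (𝓝 x) := by
    have := hg.continuousAt.tendsto
    rwa [show hs.localInverse Φ e x (Φ x) = x from hgx] at this
  refine ⟨F ∘ g, F'.comp (e.symm : E d →L[ℝ] E d), ?_, ?_, ?_, ?_⟩
  · intro h0
    apply hF'
    ext w
    have := congrArg (fun l : E d →L[ℝ] ℝ => l (e w)) h0
    simpa using this
  · exact HasFDerivAt.comp (Φ x) (by rwa [hgx]) hg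
  · simp [hgx, hFx]
  · obtain ⟨N, hN, hNo, hxN⟩ := eventually_nhds_iff.1 hs.eventually_left_inverse
    have hK : IsCompact (Φ '' (closure Ω \ N)) := (hΩ.diff hNo).image hΦ.continuous
    have hxK : Φ x ∉ Φ '' (closure Ω \ N) := by
      rintro ⟨z, ⟨hz, hzN⟩, hzx⟩
      exact hzN (hinv.1 hz hx hzx ▸ hxN)
    filter_upwards [hs.eventually_right_inverse, hgt.eventually hFΩ,
      hK.isClosed.isOpen_compl.mem_nhds hxK] with y h1 h2 h3
    rw [Function.comp_apply, ← h2]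
    constructor
    · rintro ⟨z, hz, rfl⟩
      have hzN : z ∈ N := by
        by_contra hzN
        exact h3 ⟨z, ⟨subset_closure hz, hzN⟩, rfl⟩
      rw [show g (Φ z) = z from hN z hzN]
      exact hz
    · intro hy
      exact ⟨g y, hy, h1⟩

/-! ### The boundary of a Lipschitz domain -/

theorem _root_.LipschitzOnWith.euclideanHausdorffMeasure_image_le {X Y : Type*} [EMetricSpace X]
    [EMetricSpace Y] [MeasurableSpace X] [BorelSpace X] [MeasurableSpace Y] [BorelSpace Y]
    {K : NNReal} {f : X → Y} {s : Set X} (h : LipschitzOnWith K f s) (n : ℕ) :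
    Measure.euclideanHausdorffMeasure n (f '' s)
      ≤ (K : ENNReal) ^ n * Measure.euclideanHausdorffMeasure n s := by
  simp only [Measure.euclideanHausdorffMeasure_def, Measure.smul_apply, ENNReal.smul_def,
    smul_eq_mul]
  rw [mul_left_comm]
  have := h.hausdorffMeasure_image_le (d := n) (Nat.cast_nonneg n)
  rw [ENNReal.rpow_natCast] at this
  gcongr

/-- Near a boundary point, the boundary of a Lipschitz domain lies in a Lipschitz image of a bounded
subset of a hyperplane, and by Rademacher's theorem `Ω` has a defining function at all boundary
points outside a surface null set. -/
theorem IsLipschitzDomain.boundary_local {Ω : Set (E d)} (hΩ : IsLipschitzDomain Ω) {x₀ : E d}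
    (hx₀ : x₀ ∈ frontier Ω) : ∃ r > 0,
      Measure.euclideanHausdorffMeasure (d - 1) (Metric.ball x₀ r ∩ frontier Ω) < ⊤ ∧
      Measure.euclideanHausdorffMeasure (d - 1)
        (Metric.ball x₀ r ∩ {x ∈ frontier Ω | ¬ HasDefiningFunction Ω x}) = 0 := by
  obtain ⟨ν, h, C, r, hν, hLip, hr, hgr⟩ := hΩ.locallyGraph x₀ hx₀
  refine ⟨r, hr, ?_⟩
  have hν0 : ν ≠ 0 := by rintro rfl; simp at hν
  set H : Submodule ℝ (E d) := (Submodule.span ℝ {ν})ᗮ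
  have hproj : ∀ y : E d, ((H.orthogonalProjectionOnto y : H) : E d)
      = y - (inner ℝ y ν : ℝ) • ν := fun y => by
    rw [Submodule.coe_orthogonalProjectionOnto_apply]
    exact tangProj_eq (Or.inl hν) y
  have hrank : Module.finrank ℝ H = d - 1 := by
    have hd : d ≠ 0 := by
      rintro rfl; exact hν0 (Subsingleton.elim _ _)
    have : Fact (Module.finrank ℝ (E d) = d - 1 + 1) := ⟨by
      rw [finrank_euclideanSpace_fin]; omega⟩
    exact Submodule.finrank_orthogonal_span_singleton hν0
  let hH : H → ℝ := fun p => h p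
  have hHLip : LipschitzWith (C * 1) hH := hLip.comp (LipschitzWith.subtype_val _)
  let g : H → E d := fun p => (p : E d) + hH p • ν
  obtain ⟨K, hg⟩ : ∃ K, LipschitzWith K g :=
    ⟨_, (LipschitzWith.subtype_val _).add
      ((ContinuousLinearMap.toSpanSingleton ℝ ν).lipschitz.comp hHLip)⟩
  -- Boundary points in the ball are the points of the graph.
  have hbd : ∀ x ∈ Metric.ball x₀ r ∩ frontier Ω,
      (inner ℝ x ν : ℝ) = h (x - (inner ℝ x ν : ℝ) • ν) := by
    rintro x ⟨hxr, hx⟩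
    have hxΩ : x ∉ Ω := by
      rw [hΩ.isOpen.frontier_eq] at hx; exact hx.2
    refine le_antisymm ?_ (not_lt.1 fun hlt => hxΩ ((hgr x hxr).2 hlt))
    by_contra! hlt
    have hopen : IsOpen {y : E d | h (y - (inner ℝ y ν : ℝ) • ν) < inner ℝ y ν} :=
      isOpen_lt (hLip.continuous.comp (by fun_prop)) (by fun_prop)
    obtain ⟨z, ⟨hz, hzr⟩, hzΩ⟩ := mem_closure_iff.1 (frontier_subset_closure hx) _
      (hopen.inter Metric.isOpen_ball) ⟨hlt, hxr⟩
    exact lt_asymm hz ((hgr z hzr).1 hzΩ)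
  have hgx : ∀ x ∈ Metric.ball x₀ r ∩ frontier Ω, g (H.orthogonalProjectionOnto x) = x := by
    intro x hx
    simp only [g, hH, hproj]
    rw [← hbd x hx]
    simp
  have hvol : ∀ s : Set H, Measure.euclideanHausdorffMeasure (d - 1) s = volume s := fun s => by
    rw [← hrank, InnerProductSpace.euclideanHausdorffMeasure_eq_volume]
  constructor
  · have hsub : Metric.ball x₀ r ∩ frontier Ω
        ⊆ g '' (H.orthogonalProjectionOnto '' Metric.closedBall x₀ r) := fun x hx =>
      ⟨_, ⟨x, Metric.ball_subset_closedBall hx.1, rfl⟩, hgx x hx⟩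
    refine (measure_mono hsub).trans_lt
      (((hg.lipschitzOnWith).euclideanHausdorffMeasure_image_le (d - 1)).trans_lt ?_)
    rw [hvol]
    exact ENNReal.mul_lt_top (ENNReal.pow_lt_top ENNReal.coe_lt_top)
      ((isCompact_closedBall x₀ r).image H.orthogonalProjectionOnto.continuous).measure_lt_top
  · set N : Set H := {p | ¬ DifferentiableAt ℝ hH p}
    have hN : volume N = 0 := hHLip.ae_differentiableAt
    have hsub : Metric.ball x₀ r ∩ {x ∈ frontier Ω | ¬ HasDefiningFunction Ω x} ⊆ g '' N := by
      rintro x ⟨hxr, hx, hnd⟩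
      refine ⟨_, fun hdiff => hnd ?_, hgx x ⟨hxr, hx⟩⟩
      have hF : HasFDerivAt (fun y : E d => (inner ℝ y ν : ℝ) - hH (H.orthogonalProjectionOnto y))
          (innerSL ℝ ν - (fderiv ℝ hH (H.orthogonalProjectionOnto x)).comp
            H.orthogonalProjectionOnto) x := by
        refine HasFDerivAt.sub ?_ (hdiff.hasFDerivAt.comp x
          H.orthogonalProjectionOnto.hasFDerivAt)
        have := (innerSL ℝ ν).hasFDerivAt (x := x)
        refine this.congr_of_eventuallyEq (Eventually.of_forall fun y => ?_)
        simp [real_inner_comm]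
      refine ⟨_, _, fun h0 => ?_, hF, ?_, ?_⟩
      · have hpν : H.orthogonalProjectionOnto ν = 0 := by
          apply Subtype.ext
          rw [hproj, real_inner_self_eq_norm_sq, hν]; simp
        have := congrArg (fun l : E d →L[ℝ] ℝ => l ν) h0
        simp [hpν, hν] at this
      · simp only [hH, hproj]
        rw [← hbd x ⟨hxr, hx⟩, sub_self]
      · filter_upwards [Metric.isOpen_ball.mem_nhds hxr] with y hy
        rw [hgr y hy]
        simp only [hH, hproj]
        rw [sub_neg]
    refine measure_mono_null hsub (le_antisymm ?_ (zero_le))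
    refine (hg.lipschitzOnWith.euclideanHausdorffMeasure_image_le (d - 1)).trans ?_
    rw [hvol, hN, mul_zero]

theorem IsLipschitzDomain.isCompact_closure {Ω : Set (E d)} (hΩ : IsLipschitzDomain Ω) :
    IsCompact (closure Ω) := hΩ.isBounded.isCompact_closure

theorem IsLipschitzDomain.isCompact_frontier {Ω : Set (E d)} (hΩ : IsLipschitzDomain Ω) :
    IsCompact (frontier Ω) :=
  hΩ.isCompact_closure.of_isClosed_subset isClosed_frontier frontier_subset_closure

theorem IsLipschitzDomain.isFiniteMeasure_surf {Ω : Set (E d)} (hΩ : IsLipschitzDomain Ω) :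
    IsFiniteMeasure (surf (frontier Ω)) := by
  refine ⟨?_⟩
  rw [surf, Measure.restrict_apply_univ]
  refine hΩ.isCompact_frontier.measure_lt_top_of_nhdsWithin fun x hx => ?_
  obtain ⟨r, hr, h, -⟩ := hΩ.boundary_local hx
  refine ⟨Metric.ball x r ∩ frontier Ω, ?_, h⟩
  rw [inter_comm]
  exact inter_mem_nhdsWithin _ (Metric.ball_mem_nhds x hr)

theorem IsLipschitzDomain.ae_hasDefiningFunction {Ω : Set (E d)} (hΩ : IsLipschitzDomain Ω) :
    ∀ᵐ x ∂(surf (frontier Ω)), HasDefiningFunction Ω x := by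
  rw [surf, ae_restrict_iff' isClosed_frontier.measurableSet]
  have hset : {x | ¬ (x ∈ frontier Ω → HasDefiningFunction Ω x)}
      = {x ∈ frontier Ω | ¬ HasDefiningFunction Ω x} := by
    ext x; simp
  rw [ae_iff, hset]
  refine measure_null_of_locally_null _ fun x hx => ?_
  obtain ⟨r, hr, -, h⟩ := hΩ.boundary_local hx.1
  refine ⟨_, ?_, h⟩
  rw [inter_comm]
  exact inter_mem_nhdsWithin _ (Metric.ball_mem_nhds x hr)

/-! ### Transport of interface fields by the domain map -/

theorem IsBoundaryPartition.subset_frontier {Ω A B C : Set (E d)}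
    (h : IsBoundaryPartition Ω A B C) : A ⊆ frontier Ω := by
  obtain ⟨U, -, rfl⟩ := h.relOpenA
  exact inter_subset_right

theorem IsBoundaryPartition.measurableSet {Ω A B C : Set (E d)}
    (h : IsBoundaryPartition Ω A B C) : MeasurableSet A := by
  obtain ⟨U, hU, rfl⟩ := h.relOpenA
  exact hU.measurableSet.inter isClosed_frontier.measurableSet

theorem surf_mono {A B : Set (E d)} (h : A ⊆ B) : surf A ≤ surf B :=
  Measure.restrict_mono h le_rfl

section Transport

variable {Ω Γ : Set (E d)} {Φ : E d → E d}

theorem continuousOn_invFunOn {X Y : Type*} [TopologicalSpace X] [Nonempty X] [TopologicalSpace Y]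
    [T2Space Y] {f : X → Y} {K : Set X} (hK : IsCompact K) (hf : ContinuousOn f K)
    (hinj : InjOn f K) : ContinuousOn (Function.invFunOn f K) (f '' K) := by
  rw [continuousOn_iff_isClosed]
  intro A hA
  refine ⟨f '' (K ∩ A), ((hK.inter_right hA).image_of_continuousOn
    (hf.mono inter_subset_left)).isClosed, ?_⟩
  ext y
  constructor
  · rintro ⟨hy, ⟨x, hx, rfl⟩⟩
    rw [mem_preimage, hinj.leftInvOn_invFunOn hx] at hy
    exact ⟨⟨x, ⟨hx, hy⟩, rfl⟩, ⟨x, hx, rfl⟩⟩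
  · rintro ⟨⟨x, ⟨hx, hxA⟩, rfl⟩, hy⟩
    refine ⟨?_, hy⟩
    rw [mem_preimage, hinj.leftInvOn_invFunOn hx]
    exact hxA

theorem measurableSet_image_interface (hinv : IsInvertibleOn Ω Φ) (hΦ : ContDiff ℝ 1 Φ)
    (hΓ : MeasurableSet Γ) (hsub : Γ ⊆ closure Ω) : MeasurableSet (Φ '' Γ) :=
  hΓ.image_of_continuousOn_injOn hΦ.continuous.continuousOn (hinv.1.mono hsub)

theorem aemeasurable_invFunOn_surf (hΩ : IsCompact (closure Ω)) (hinv : IsInvertibleOn Ω Φ)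
    (hΦ : ContDiff ℝ 1 Φ) (hΓ : MeasurableSet Γ) (hsub : Γ ⊆ closure Ω) :
    AEMeasurable (Function.invFunOn Φ (closure Ω)) (surf (Φ '' Γ)) :=
  ((continuousOn_invFunOn hΩ hΦ.continuous.continuousOn hinv.1).mono
    (image_mono hsub)).aemeasurable (measurableSet_image_interface hinv hΦ hΓ hsub)

/-- A `C¹` map stretches surface measure on a bounded surface by at most a constant factor. -/
theorem exists_map_surf_le (hΩ : IsCompact (closure Ω)) (hinv : IsInvertibleOn Ω Φ)
    (hΦ : ContDiff ℝ 1 Φ) (hΓ : MeasurableSet Γ) (hsub : Γ ⊆ closure Ω) :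
    ∃ c : ENNReal, c ≠ ⊤ ∧
      (surf (Φ '' Γ)).map (Function.invFunOn Φ (closure Ω)) ≤ c • surf Γ := by
  obtain ⟨R, hR⟩ := hΩ.isBounded.subset_closedBall 0
  obtain ⟨K, hK⟩ := hΦ.contDiffOn.exists_lipschitzOnWith one_ne_zero
    (convex_closedBall (0 : E d) R) (isCompact_closedBall 0 R)
  refine ⟨(K : ENNReal) ^ (d - 1), ENNReal.pow_ne_top ENNReal.coe_ne_top, ?_⟩
  refine Measure.le_iff.2 fun A hA => ?_
  rw [Measure.map_apply_of_aemeasurable (aemeasurable_invFunOn_surf hΩ hinv hΦ hΓ hsub) hA, surf,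
    surf, Measure.restrict_apply' (measurableSet_image_interface hinv hΦ hΓ hsub),
    Measure.smul_apply, Measure.restrict_apply hA, smul_eq_mul]
  have hset : Function.invFunOn Φ (closure Ω) ⁻¹' A ∩ Φ '' Γ ⊆ Φ '' (A ∩ Γ) := by
    rintro _ ⟨hy, ⟨x, hx, rfl⟩⟩
    rw [mem_preimage, hinv.1.leftInvOn_invFunOn (hsub hx)] at hy
    exact ⟨x, ⟨hy, hx⟩, rfl⟩
  exact (measure_mono hset).trans ((hK.mono
    ((inter_subset_right.trans hsub).trans hR)).euclideanHausdorffMeasure_image_le (d - 1))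

theorem ae_surf_image (hΩ : IsCompact (closure Ω)) (hinv : IsInvertibleOn Ω Φ)
    (hΦ : ContDiff ℝ 1 Φ) (hΓ : MeasurableSet Γ) (hsub : Γ ⊆ closure Ω) {p : E d → Prop}
    (h : ∀ᵐ x ∂(surf Γ), p x) :
    ∀ᵐ y ∂(surf (Φ '' Γ)), p (Function.invFunOn Φ (closure Ω) y) := by
  obtain ⟨c, hc, hle⟩ := exists_map_surf_le hΩ hinv hΦ hΓ hsub
  refine ae_of_ae_map (aemeasurable_invFunOn_surf hΩ hinv hΦ hΓ hsub) ?_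
  exact (Measure.absolutelyContinuous_of_le_smul hle).ae_le h

theorem memLp_push {F : Type*} [NormedAddCommGroup F] (hΩ : IsCompact (closure Ω))
    (hinv : IsInvertibleOn Ω Φ) (hΦ : ContDiff ℝ 1 Φ) (hΓ : MeasurableSet Γ)
    (hsub : Γ ⊆ closure Ω) {f : E d → F} (hf : MemLp f 2 (surf Γ)) :
    MemLp (push Φ Ω f) 2 (surf (Φ '' Γ)) := by
  obtain ⟨c, hc, hle⟩ := exists_map_surf_le hΩ hinv hΦ hΓ hsub
  exact (hf.of_measure_le_smul hc hle).comp_of_map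
    (aemeasurable_invFunOn_surf hΩ hinv hΦ hΓ hsub)

theorem isFiniteMeasure_surf_image (hΩ : IsCompact (closure Ω)) (hinv : IsInvertibleOn Ω Φ)
    (hΦ : ContDiff ℝ 1 Φ) (hΓ : MeasurableSet Γ) (hsub : Γ ⊆ closure Ω)
    [IsFiniteMeasure (surf Γ)] : IsFiniteMeasure (surf (Φ '' Γ)) := by
  obtain ⟨c, hc, hle⟩ := exists_map_surf_le hΩ hinv hΦ hΓ hsub
  refine ⟨?_⟩
  rw [← preimage_univ (f := Function.invFunOn Φ (closure Ω)),
    ← Measure.map_apply_of_aemeasurable (aemeasurable_invFunOn_surf hΩ hinv hΦ hΓ hsub)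
      MeasurableSet.univ]
  refine (hle univ).trans_lt ?_
  rw [Measure.smul_apply, smul_eq_mul]
  exact ENNReal.mul_lt_top hc.lt_top (measure_lt_top _ _)

theorem ae_invFunOn_eq (hinv : IsInvertibleOn Ω Φ) (hΦ : ContDiff ℝ 1 Φ) (hΓ : MeasurableSet Γ)
    (hsub : Γ ⊆ closure Ω) :
    ∀ᵐ y ∂(surf (Φ '' Γ)), Φ (Function.invFunOn Φ (closure Ω) y) = y := by
  rw [surf, ae_restrict_iff' (measurableSet_image_interface hinv hΦ hΓ hsub)]
  refine Eventually.of_forall ?_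
  rintro _ ⟨x, hx, rfl⟩
  exact Function.invFunOn_apply_eq (hsub hx)

/-- The deformed domain has an outward normal almost everywhere on the deformed interface, although
it need not be presented as a Lipschitz domain: defining functions are transported. -/
theorem ae_exists_isOuterNormal_image (hΩ : IsLipschitzDomain Ω) (hinv : IsInvertibleOn Ω Φ)
    (hΦ : ContDiff ℝ 1 Φ) (hΓ : MeasurableSet Γ) (hsub : Γ ⊆ frontier Ω) :
    ∀ᵐ y ∂(surf (Φ '' Γ)), ∃ ν, IsOuterNormal (Φ '' Ω) y ν := by
  have hsub' := hsub.trans frontier_subset_closure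
  have h1 : ∀ᵐ x ∂(surf Γ), HasDefiningFunction Ω x ∧ x ∈ Γ := by
    filter_upwards [ae_mono (surf_mono hsub) hΩ.ae_hasDefiningFunction,
      ae_restrict_mem hΓ] with x h h' using ⟨h, h'⟩
  filter_upwards [ae_surf_image hΩ.isCompact_closure hinv hΦ hΓ hsub' h1,
    ae_invFunOn_eq hinv hΦ hΓ hsub'] with y hy hy'
  have := (hy.1.image hΩ.isCompact_closure hΦ hinv (hsub' hy.2)).exists_isOuterNormal
  rwa [hy'] at this

end Transport

/-! ### Square integrability of normal and tangential components -/

theorem memLp_nrm {μ : Measure (E d)} (Ω : Set (E d)) {v : E d → E d} (hv : MemLp v 2 μ) :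
    MemLp (nrm (outerNormal Ω) v) 2 μ := by
  refine hv.mono (hv.1.inner (measurable_outerNormal Ω).aestronglyMeasurable)
    (Eventually.of_forall fun x => ?_)
  refine (norm_inner_le_norm _ _).trans ?_
  exact mul_le_of_le_one_right (norm_nonneg _) (norm_outerNormal_le Ω x)

theorem memLp_tan {μ : Measure (E d)} (Ω : Set (E d)) {v : E d → E d} (hv : MemLp v 2 μ) :
    MemLp (tan (outerNormal Ω) v) 2 μ := by
  have hfun : tan (outerNormal Ω) v
      = fun x => v x - nrm (outerNormal Ω) v x • outerNormal Ω x := by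
    ext1 x; exact tangProj_outerNormal Ω x (v x)
  have hmeas : AEStronglyMeasurable (tan (outerNormal Ω) v) μ := by
    rw [hfun]
    exact hv.1.sub ((memLp_nrm Ω hv).1.smul (measurable_outerNormal Ω).aestronglyMeasurable)
  refine hv.mono hmeas (Eventually.of_forall fun x => ?_)
  exact Submodule.norm_starProjection_apply_le _ _

theorem tan_sub (n v w : E d → E d) (x : E d) :
    tan n (fun y => v y - w y) x = tan n v x - tan n w x := tangProj_sub _ _ _

theorem nrm_sub (n v w : E d → E d) (x : E d) :
    nrm n (fun y => v y - w y) x = nrm n v x - nrm n w x := inner_sub_left _ _ _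

section Pair

variable {F : Type*} [NormedAddCommGroup F] [InnerProductSpace ℝ F] {μ : Measure (E d)}

theorem integrable_inner_of_memLp {f g : E d → F} (hf : MemLp f 2 μ) (hg : MemLp g 2 μ) :
    Integrable (fun x => (inner ℝ (f x) (g x) : ℝ)) μ := by
  refine (hf.norm.integrable_mul hg.norm).mono (hf.1.inner hg.1) (Eventually.of_forall fun x => ?_)
  simpa using abs_real_inner_le_norm (f x) (g x)

theorem pair_add_left {f f' g : E d → F} (hf : MemLp f 2 μ) (hf' : MemLp f' 2 μ)
    (hg : MemLp g 2 μ) : pair μ (fun x => f x + f' x) g = pair μ f g + pair μ f' g := by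
  simp only [pair, inner_add_left]
  exact integral_add (integrable_inner_of_memLp hf hg) (integrable_inner_of_memLp hf' hg)

theorem pair_sub_left {f f' g : E d → F} (hf : MemLp f 2 μ) (hf' : MemLp f' 2 μ)
    (hg : MemLp g 2 μ) : pair μ (fun x => f x - f' x) g = pair μ f g - pair μ f' g := by
  simp only [pair, inner_sub_left]
  exact integral_sub (integrable_inner_of_memLp hf hg) (integrable_inner_of_memLp hf' hg)

theorem pair_smul_left (c : ℝ) (f g : E d → F) :
    pair μ (fun x => c • f x) g = c * pair μ f g := by
  simp only [pair, real_inner_smul_left]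
  exact integral_const_mul _ _

theorem pair_mul_left (c : ℝ) (f g : E d → ℝ) :
    pair μ (fun x => c * f x) g = c * pair μ f g := pair_smul_left c f g

theorem pair_eq_zero_left {f g : E d → F} (hf : ∀ᵐ x ∂μ, f x = 0) : pair μ f g = 0 := by
  rw [pair, integral_eq_zero_of_ae]
  filter_upwards [hf] with x hx
  simp [hx]

theorem pair_eq_zero_right {f g : E d → F} (hg : ∀ᵐ x ∂μ, g x = 0) : pair μ f g = 0 := by
  rw [pair, integral_eq_zero_of_ae]
  filter_upwards [hg] with x hx
  simp [hx]

end Pair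

/-! ### Traces of smooth functions and test functions -/

section Trace

variable {F : Type*} [NormedAddCommGroup F] {Ω : Set (E d)}

theorem hasTrace_trace {f g : E d → F} (h : HasTrace Ω f g) : HasTrace Ω f (trace Ω f) := by
  have h' : ∃ g, HasTrace Ω f g := ⟨g, h⟩
  rw [trace, dif_pos h']; exact h'.choose_spec

/-- Traces of locally integrable functions are unique; integrability is needed because the mean
value of a non-integrable function is `0` by convention. -/
theorem HasTrace.ae_eq (hΩ : IsOpen Ω) {f g g' : E d → F} (hf : LocallyIntegrable f)
    (h : HasTrace Ω f g) (h' : HasTrace Ω f g') : ∀ᵐ x ∂(surf (frontier Ω)), g x = g' x := by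
  filter_upwards [h.2, h'.2, ae_restrict_mem isClosed_frontier.measurableSet] with x hx hx' hxf
  have hle : ∀ᶠ r : ℝ in 𝓝[>] 0, ‖g x - g' x‖ ≤ (⨍ y in Metric.ball x r ∩ Ω, ‖f y - g x‖)
      + ⨍ y in Metric.ball x r ∩ Ω, ‖f y - g' x‖ := by
    filter_upwards [self_mem_nhdsWithin] with r hr
    have hr : (0 : ℝ) < r := hr
    have hpos : volume (Metric.ball x r ∩ Ω) ≠ 0 := by
      refine ((Metric.isOpen_ball.inter hΩ).measure_pos volume ?_).ne'
      obtain ⟨y, hy, hyΩ⟩ := mem_closure_iff.1 (frontier_subset_closure hxf) _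
        Metric.isOpen_ball (Metric.mem_ball_self hr)
      exact ⟨y, hy, hyΩ⟩
    have hfin : volume (Metric.ball x r ∩ Ω) ≠ ⊤ :=
      measure_ne_top_of_subset inter_subset_left Metric.isBounded_ball.measure_lt_top.ne
    have hint : ∀ a : F, IntegrableOn (fun y => ‖f y - a‖) (Metric.ball x r ∩ Ω) := fun a =>
      ((((hf.integrableOn_isCompact (isCompact_closedBall x r)).mono_set
        (inter_subset_left.trans Metric.ball_subset_closedBall)).sub
          (integrableOn_const hfin)).norm)
    have hm : 0 < volume.real (Metric.ball x r ∩ Ω) :=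
      ENNReal.toReal_pos hpos hfin
    rw [setAverage_eq, setAverage_eq, ← smul_add, ← integral_add (hint _) (hint _), smul_eq_mul,
      ← div_eq_inv_mul, le_div_iff₀ hm]
    have hc : ‖g x - g' x‖ * volume.real (Metric.ball x r ∩ Ω)
        = ∫ _y in Metric.ball x r ∩ Ω, ‖g x - g' x‖ := by
      rw [setIntegral_const, smul_eq_mul, mul_comm]
    rw [hc]
    refine integral_mono (integrableOn_const hfin) ((hint _).add (hint _)) fun y => ?_
    calc ‖g x - g' x‖ = ‖(f y - g' x) - (f y - g x)‖ := by congr 1; abel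
      _ ≤ ‖f y - g' x‖ + ‖f y - g x‖ := norm_sub_le _ _
      _ = _ := add_comm _ _
  have hlim := hx.add hx'
  rw [add_zero] at hlim
  have := ge_of_tendsto hlim hle
  exact sub_eq_zero.1 (norm_le_zero_iff.1 this)

theorem hasTrace_of_continuous (hΩ : IsLipschitzDomain Ω) {f : E d → F} (hf : Continuous f)
    (hcs : HasCompactSupport f) : HasTrace Ω f f := by
  have := hΩ.isFiniteMeasure_surf
  refine ⟨hf.memLp_of_hasCompactSupport hcs, Eventually.of_forall fun x => ?_⟩
  rw [Metric.tendsto_nhds]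
  intro ε hε
  obtain ⟨δ, hδ, H⟩ := Metric.continuousAt_iff.1 hf.continuousAt (ε / 2) (half_pos hε)
  filter_upwards [Ioo_mem_nhdsGT hδ] with r hr
  rw [dist_zero_right]
  refine lt_of_le_of_lt ?_ (half_lt_self hε)
  have hfin : volume (Metric.ball x r ∩ Ω) < ⊤ :=
    (measure_mono inter_subset_left).trans_lt Metric.isBounded_ball.measure_lt_top
  have hb : ‖∫ y in Metric.ball x r ∩ Ω, ‖f y - f x‖‖
      ≤ ε / 2 * volume.real (Metric.ball x r ∩ Ω) := by
    refine norm_setIntegral_le_of_norm_le_const hfin fun y hy => ?_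
    rw [norm_norm, ← dist_eq_norm]
    exact (H ((Metric.mem_ball.1 hy.1).trans hr.2)).le
  rw [setAverage_eq, norm_smul, norm_inv, Real.norm_of_nonneg measureReal_nonneg]
  rcases measureReal_nonneg (μ := volume) (s := Metric.ball x r ∩ Ω) |>.eq_or_lt with h0 | h0
  · rw [← h0]; simpa using (half_pos hε).le
  · rw [← div_eq_inv_mul, div_le_iff₀ h0]; exact hb

theorem trace_ae_eq_of_continuous (hΩ : IsLipschitzDomain Ω) {f : E d → F} (hf : Continuous f)
    (hcs : HasCompactSupport f) : ∀ᵐ x ∂(surf (frontier Ω)), trace Ω f x = f x :=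
  HasTrace.ae_eq hΩ.isOpen hf.locallyIntegrable
    (hasTrace_trace (hasTrace_of_continuous hΩ hf hcs)) (hasTrace_of_continuous hΩ hf hcs)

/-- A function supported in an open set that meets `∂Ω` only in `Γ` vanishes on the other parts of
the boundary. -/
theorem traceZeroOn_of_tsupport_subset (hΩ : IsLipschitzDomain Ω) {f : E d → F} (hf : Continuous f)
    (hcs : HasCompactSupport f) {U Γ S N : Set (E d)} (hpart : IsBoundaryPartition Ω Γ S N)
    (hUΓ : U ∩ frontier Ω = Γ) (hsupp : tsupport f ⊆ U) : TraceZeroOn Ω S f := by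
  refine ⟨hasTrace_trace (hasTrace_of_continuous hΩ hf hcs), ?_⟩
  obtain ⟨V, hV, hVS⟩ := hpart.relOpenB
  have hS : S ⊆ frontier Ω := hVS ▸ inter_subset_right
  have hmeas : MeasurableSet S := hVS ▸ hV.measurableSet.inter isClosed_frontier.measurableSet
  filter_upwards [ae_mono (surf_mono hS) (trace_ae_eq_of_continuous hΩ hf hcs),
    ae_restrict_mem hmeas] with x hx hxS
  rw [hx]
  refine image_eq_zero_of_notMem_tsupport fun hxs => ?_
  exact disjoint_left.1 hpart.disjAB (hUΓ ▸ ⟨hsupp hxs, hS hxS⟩) hxS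

end Trace

theorem memH1_of_contDiff (Ω : Set (E d)) {f : E d → ℝ} (hf : ContDiff ℝ ∞ f)
    (hcs : HasCompactSupport f) : MemH1 Ω f := by
  refine ⟨hf.continuous.memLp_of_hasCompactSupport hcs, fun j => ?_⟩
  have hc : ∀ {θ : E d → ℝ}, ContDiff ℝ ∞ θ →
      Continuous fun x => fderiv ℝ θ x (EuclideanSpace.single j 1) := fun hθ =>
    (hθ.continuous_fderiv (by simp)).clm_apply continuous_const
  have hs : ∀ {θ : E d → ℝ}, HasCompactSupport θ →
      HasCompactSupport fun x => fderiv ℝ θ x (EuclideanSpace.single j 1) := fun hθ =>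
    hθ.fderiv_apply ℝ _
  refine ⟨fun x => fderiv ℝ f x (EuclideanSpace.single j 1),
    (hc hf).memLp_of_hasCompactSupport (hs hcs), fun θ hθ hθc hθΩ => ?_⟩
  have h0 : ∀ x, x ∉ Ω → x ∉ tsupport θ := fun x hx h => hx (hθΩ h)
  rw [setIntegral_eq_integral_of_forall_compl_eq_zero,
    setIntegral_eq_integral_of_forall_compl_eq_zero]
  · refine integral_mul_fderiv_eq_neg_fderiv_mul_of_integrable ?_ ?_ ?_ ?_ ?_
    · exact ((hc hf).mul hθ.continuous).integrable_of_hasCompactSupport (hθc.mul_left)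
    · exact (hf.continuous.mul (hc hθ)).integrable_of_hasCompactSupport (hcs.mul_right)
    · exact (hf.continuous.mul hθ.continuous).integrable_of_hasCompactSupport (hcs.mul_right)
    · exact fun x _ => (hf.differentiable (by simp)) x
    · exact fun x _ => (hθ.differentiable (by simp)) x
  · intro x hx
    rw [image_eq_zero_of_notMem_tsupport (h0 x hx), mul_zero]
  · intro x hx
    rw [image_eq_zero_of_notMem_tsupport (f := fderiv ℝ θ)
      fun h => h0 x hx (tsupport_fderiv_subset ℝ h)]
    simp

section TestFunctions

variable {Ω U Γ S N : Set (E d)} {θ : E d → ℝ}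

theorem memScalarSpace_of_contDiff (hΩ : IsLipschitzDomain Ω) (hpart : IsBoundaryPartition Ω Γ S N)
    (hUΓ : U ∩ frontier Ω = Γ) (hθ : ContDiff ℝ ∞ θ) (hcs : HasCompactSupport θ)
    (hsupp : tsupport θ ⊆ U) : MemScalarSpace Ω S θ :=
  ⟨memH1_of_contDiff Ω hθ hcs,
    traceZeroOn_of_tsupport_subset hΩ hθ.continuous hcs hpart hUΓ hsupp⟩

theorem memVectorSpace_of_contDiff (hΩ : IsLipschitzDomain Ω) (hpart : IsBoundaryPartition Ω Γ S N)
    (hUΓ : U ∩ frontier Ω = Γ) (hθ : ContDiff ℝ ∞ θ) (hcs : HasCompactSupport θ)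
    (hsupp : tsupport θ ⊆ U) (e : E d) : MemVectorSpace Ω S fun x => θ x • e := by
  have hsub : tsupport (fun x => θ x • e) ⊆ tsupport θ :=
    closure_mono fun x hx => left_ne_zero_of_smul hx
  refine ⟨fun i => ?_, traceZeroOn_of_tsupport_subset hΩ (hθ.continuous.smul continuous_const)
    hcs.smul_right hpart hUΓ (hsub.trans hsupp)⟩
  exact memH1_of_contDiff Ω (f := fun x => θ x * e i) (hθ.mul contDiff_const) hcs.mul_right

/-! ### Fields on the interface orthogonal to all traces vanish -/

variable {μ : Measure (E d)} {Φ Ψ : E d → E d}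

/-- The fundamental lemma of the calculus of variations for a measure `μ` on a deformed interface:
`Ψ`, with inverse `Φ`, maps to the reference configuration, where the test functions live. -/
theorem ae_eq_zero_of_integral_smul_comp (hU : IsOpen U) (hΨ : AEMeasurable Ψ μ)
    (hΦ : Measurable Φ) (hinv : ∀ᵐ y ∂μ, Φ (Ψ y) = y) (hmem : ∀ᵐ y ∂μ, Ψ y ∈ U) {f : E d → ℝ}
    (hf : Integrable f μ)
    (h : ∀ θ : E d → ℝ, ContDiff ℝ ∞ θ → HasCompactSupport θ → tsupport θ ⊆ U →
      ∫ y, θ (Ψ y) * f y ∂μ = 0) : ∀ᵐ y ∂μ, f y = 0 := by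
  have hmap : (μ.map Ψ).map Φ = μ := by
    rw [AEMeasurable.map_map_of_aemeasurable hΦ.aemeasurable hΨ,
      Measure.map_congr (show Φ ∘ Ψ =ᵐ[μ] id from hinv), Measure.map_id]
  have hf' : Integrable (f ∘ Φ) (μ.map Ψ) := by
    refine Integrable.comp_measurable ?_ hΦ
    rwa [hmap]
  have hz := hU.ae_eq_zero_of_integral_contDiff_smul_eq_zero (μ := μ.map Ψ) (f := f ∘ Φ)
    (hf'.locallyIntegrable.locallyIntegrableOn U) fun θ hθ hcs hsupp => by
      rw [integral_map (f := fun x => θ x • (f ∘ Φ) x) hΨ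
        (hθ.continuous.aestronglyMeasurable.smul hf'.1), ← h θ hθ hcs hsupp]
      refine integral_congr_ae ?_
      filter_upwards [hinv] with y hy
      simp [hy]
  filter_upwards [ae_of_ae_map hΨ hz, hmem, hinv] with y h1 h2 h3
  simpa [h3] using h1 h2

/-- If `a n + b`, with `b` tangential, is orthogonal to all traces of admissible velocity fields,
then `a` and `b` vanish: components of `a n + b` are tested with `θ eᵢ`. -/
theorem ae_eq_zero_of_pair_nrm_add_pair_tan [IsFiniteMeasure μ] (hΩ : IsLipschitzDomain Ω)
    (hpart : IsBoundaryPartition Ω Γ S N) (hΨ : AEMeasurable Ψ μ) (hΦ : Measurable Φ)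
    (hinv : ∀ᵐ y ∂μ, Φ (Ψ y) = y)
    (hae : ∀ {p : E d → Prop}, (∀ᵐ x ∂(surf Γ), p x) → ∀ᵐ y ∂μ, p (Ψ y))
    {Ω' : Set (E d)} (hn : ∀ᵐ y ∂μ, ∃ ν, IsOuterNormal Ω' y ν)
    {a : E d → ℝ} {b : E d → E d} (ha : MemLp a 2 μ) (hb : MemLp b 2 μ)
    (hbt : ∀ᵐ y ∂μ, tangProj (outerNormal Ω' y) (b y) = b y)
    (h : ∀ v, MemVectorSpace Ω S v →
      pair μ a (nrm (outerNormal Ω') (trace Ω v ∘ Ψ))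
        + pair μ b (tan (outerNormal Ω') (trace Ω v ∘ Ψ)) = 0) :
    (∀ᵐ y ∂μ, a y = 0) ∧ ∀ᵐ y ∂μ, b y = 0 := by
  obtain ⟨U, hU, hUΓ⟩ := hpart.relOpenA
  have hmem : ∀ᵐ y ∂μ, Ψ y ∈ U := hae (by
    filter_upwards [ae_restrict_mem hpart.measurableSet] with x hx
    exact (hUΓ ▸ hx : x ∈ U ∩ frontier Ω).1)
  set n := outerNormal Ω'
  have hnm : MemLp n 2 μ := MemLp.of_bound (measurable_outerNormal Ω').aestronglyMeasurable 1
    (Eventually.of_forall (norm_outerNormal_le Ω'))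
  have hcomp : ∀ i, ∀ᵐ y ∂μ, a y * n y i + b y i = 0 := fun i => by
    have hni : MemLp (fun y => n y i) 2 μ :=
      hnm.continuousLinearMap_comp (EuclideanSpace.proj (𝕜 := ℝ) i)
    have hbi : MemLp (fun y => b y i) 2 μ :=
      hb.continuousLinearMap_comp (EuclideanSpace.proj (𝕜 := ℝ) i)
    refine ae_eq_zero_of_integral_smul_comp hU hΨ hΦ hinv hmem
      ((ha.integrable_mul hni).add (hbi.integrable one_le_two)) fun θ hθ hcs hsupp => ?_
    have hv := memVectorSpace_of_contDiff hΩ hpart hUΓ hθ hcs hsupp (EuclideanSpace.single i 1)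
    have htr : ∀ᵐ y ∂μ, trace Ω (fun x => θ x • EuclideanSpace.single i (1 : ℝ)) (Ψ y)
        = θ (Ψ y) • EuclideanSpace.single i (1 : ℝ) :=
      hae (ae_mono (surf_mono hpart.subset_frontier)
        (trace_ae_eq_of_continuous hΩ (hθ.continuous.smul continuous_const) hcs.smul_right))
    obtain ⟨M, hM⟩ := hcs.exists_bound_of_continuous hθ.continuous
    have hθm : MemLp (fun y => θ (Ψ y)) 2 μ := MemLp.of_bound
      (hθ.continuous.measurable.comp_aemeasurable hΨ).aestronglyMeasurable M
      (Eventually.of_forall fun y => hM _)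
    have hV : MemLp (trace Ω (fun x => θ x • EuclideanSpace.single i (1 : ℝ)) ∘ Ψ) 2 μ := by
      refine MemLp.ae_eq (f := fun y => θ (Ψ y) • EuclideanSpace.single i (1 : ℝ)) ?_ ?_
      · filter_upwards [htr] with y hy using hy.symm
      · exact hθm.continuousLinearMap_comp
          (ContinuousLinearMap.toSpanSingleton ℝ (EuclideanSpace.single i (1 : ℝ)))
    rw [← h _ hv, pair, pair,
      ← integral_add (integrable_inner_of_memLp ha (memLp_nrm Ω' hV))
        (integrable_inner_of_memLp hb (memLp_tan Ω' hV))]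
    refine integral_congr_ae ?_
    filter_upwards [htr, hbt] with y hy hby
    simp only [tan]
    rw [inner_tangProj_right, hby]
    simp only [nrm, Function.comp_apply, hy, inner_smul_left, inner_smul_right,
      EuclideanSpace.inner_single_left, EuclideanSpace.inner_single_right]
    simp
    ring
  have hz : ∀ᵐ y ∂μ, a y = 0 ∧ b y = 0 := by
    filter_upwards [ae_all_iff.2 hcomp, hn, hbt] with y hy hny hby
    have hsum : a y • n y + b y = 0 := by
      ext i; simpa using hy i
    have hbn : (inner ℝ (b y) (n y) : ℝ) = 0 := by
      rw [← hby]; exact inner_tangProj_self _ _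
    have h1 : ‖n y‖ = 1 := norm_outerNormal hny
    have ha0 : a y = 0 := by
      have := congrArg (fun w => (inner ℝ w (n y) : ℝ)) hsum
      simpa [inner_add_left, inner_smul_left, hbn, real_inner_self_eq_norm_sq, h1] using this
    refine ⟨ha0, ?_⟩
    simpa [ha0] using hsum
  exact ⟨hz.mono fun y h => h.1, hz.mono fun y h => h.2⟩

theorem ae_eq_zero_of_pair_trace (hΩ : IsLipschitzDomain Ω)
    (hpart : IsBoundaryPartition Ω Γ S N) {a : E d → ℝ} (ha : MemLp a 2 (surf Γ))
    (h : ∀ ψ, MemScalarSpace Ω S ψ → pair (surf Γ) a (trace Ω ψ) = 0) :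
    ∀ᵐ y ∂(surf Γ), a y = 0 := by
  obtain ⟨U, hU, hUΓ⟩ := hpart.relOpenA
  have := hΩ.isFiniteMeasure_surf
  have : IsFiniteMeasure (surf Γ) :=
    isFiniteMeasure_of_le _ (surf_mono hpart.subset_frontier)
  refine ae_eq_zero_of_integral_smul_comp (Ψ := id) (Φ := id) hU aemeasurable_id measurable_id
    (Eventually.of_forall fun _ => rfl) ?_ (ha.integrable one_le_two) fun θ hθ hcs hsupp => ?_
  · filter_upwards [ae_restrict_mem hpart.measurableSet] with x hx
    exact (hUΓ ▸ hx : x ∈ U ∩ frontier Ω).1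
  · rw [← h θ (memScalarSpace_of_contDiff hΩ hpart hUΓ hθ hcs hsupp), pair]
    refine integral_congr_ae ?_
    filter_upwards [ae_mono (surf_mono hpart.subset_frontier)
      (trace_ae_eq_of_continuous hΩ hθ.continuous hcs)] with y hy
    rw [hy]
    simp [mul_comm]

end TestFunctions

/-! ### The maximum principle and uniqueness of the harmonic extension -/

open InnerProductSpace Laplacian in
theorem not_isLocalMax_of_laplacian_pos {g : E d → ℝ} {x : E d} (hg : ContDiffAt ℝ 2 g x)
    (hΔ : 0 < (Δ g) x) : ¬ IsLocalMax g x := by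
  intro hmax
  rw [laplacian_eq_iteratedFDeriv_stdOrthonormalBasis] at hΔ
  obtain ⟨i, -, hi⟩ := Finset.exists_lt_of_sum_lt (f := fun _ => (0 : ℝ))
    (by simpa only [Finset.sum_const_zero] using hΔ)
  rw [iteratedFDeriv_two_apply] at hi
  simp only [Matrix.cons_val_zero, Matrix.cons_val_one] at hi
  set e := stdOrthonormalBasis ℝ (E d) i
  -- Restrict to the line through `x` in the direction of positive second derivative.
  let φ : ℝ → ℝ := fun s => g (x + s • e)
  have hline : ∀ s : ℝ, HasDerivAt (fun s : ℝ => x + s • e) e s := fun s => by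
    simpa using ((hasDerivAt_id s).smul_const e).const_add x
  have hcont : Tendsto (fun s : ℝ => x + s • e) (𝓝 0) (𝓝 x) := by
    simpa using (hline 0).continuousAt.tendsto
  have hφ' : deriv φ =ᶠ[𝓝 0] fun s => fderiv ℝ g (x + s • e) e := by
    filter_upwards [hcont.eventually (hg.eventually (by simp))] with s hs
    exact ((hs.differentiableAt (by simp)).hasFDerivAt.comp_hasDerivAt s (hline s)).deriv
  have hφ'' : deriv (deriv φ) 0 = fderiv ℝ (fderiv ℝ g) x e e := by
    rw [hφ'.deriv_eq]
    have h2 : HasFDerivAt (fderiv ℝ g) (fderiv ℝ (fderiv ℝ g) x) (x + (0 : ℝ) • e) := by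
      rw [zero_smul, add_zero]
      exact ((hg.fderiv_right (m := 1) (by norm_num)).differentiableAt one_ne_zero).hasFDerivAt
    have h3 : HasDerivAt (fun s : ℝ => fderiv ℝ g (x + s • e)) (fderiv ℝ (fderiv ℝ g) x e) 0 :=
      HasFDerivAt.comp_hasDerivAt (f := fun s : ℝ => x + s • e) (0 : ℝ) h2 (hline 0)
    exact (((ContinuousLinearMap.apply ℝ ℝ e).hasFDerivAt).comp_hasDerivAt (0 : ℝ) h3).deriv
  have hφmax : IsLocalMax φ 0 := by
    have := hcont.eventually hmax
    simpa [IsLocalMax, IsMaxFilter, φ] using this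
  have hφc : ContinuousAt φ 0 := by
    have h0 : x + (0 : ℝ) • e = x := by simp
    exact ContinuousAt.comp (g := g) (by rw [h0]; exact hg.continuousAt) (hline 0).continuousAt
  have hφmin : IsLocalMin φ 0 :=
    isLocalMin_of_deriv_deriv_pos (hφ''.symm ▸ hi) hφmax.deriv_eq_zero hφc
  -- A local maximum that is also a local minimum is flat.
  have hflat : φ =ᶠ[𝓝 0] fun _ => φ 0 := by
    filter_upwards [hφmax, hφmin] with s h1 h2 using le_antisymm h1 h2
  have : deriv (deriv φ) 0 = 0 := by
    rw [hflat.deriv.deriv_eq]; simp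
  rw [hφ''] at this
  exact hi.ne' this

open InnerProductSpace Laplacian in
theorem laplacian_norm_sq (x : E d) : (Δ (fun y : E d => ‖y‖ ^ 2)) x = 2 * (d : ℝ) := by
  rw [laplacian_eq_iteratedFDeriv_stdOrthonormalBasis]
  have h1 : fderiv ℝ (fun y : E d => ‖y‖ ^ 2) = ⇑((2 : ℝ) • innerSL ℝ (E := E d)) := by
    ext1 y
    rw [(hasStrictFDerivAt_norm_sq y).hasFDerivAt.fderiv]
    ext w; simp [two_mul]
  have h2 : ∀ i, iteratedFDeriv ℝ 2 (fun y : E d => ‖y‖ ^ 2) x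
      ![stdOrthonormalBasis ℝ (E d) i, stdOrthonormalBasis ℝ (E d) i] = 2 := fun i => by
    rw [iteratedFDeriv_two_apply, h1, ContinuousLinearMap.fderiv]
    change 2 * inner ℝ (stdOrthonormalBasis ℝ (E d) i) (stdOrthonormalBasis ℝ (E d) i) = (2 : ℝ)
    rw [real_inner_self_eq_norm_sq, (stdOrthonormalBasis ℝ (E d)).orthonormal.1 i, one_pow, mul_one]
  simp [h2, mul_comm]

open InnerProductSpace Laplacian in
/-- The weak maximum principle, by perturbation with `ε ‖x‖²`. -/
theorem le_zero_of_harmonicOnNhd (hd : 0 < d) {Ω : Set (E d)} (hΩ : IsOpen Ω)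
    (hb : Bornology.IsBounded Ω) {h : E d → ℝ} (hc : Continuous h) (hh : HarmonicOnNhd h Ω)
    (hle : ∀ x ∈ frontier Ω, h x ≤ 0) : ∀ x ∈ closure Ω, h x ≤ 0 := by
  intro x₀ hx₀
  by_contra! hpos
  have hK : IsCompact (closure Ω) := hb.isCompact_closure
  obtain ⟨R, hR⟩ := hK.exists_bound_of_continuousOn (f := fun x : E d => ‖x‖ ^ 2) (by fun_prop)
  have hR0 : 0 ≤ R := (norm_nonneg _).trans (hR x₀ hx₀)
  set ε := h x₀ / (2 * (R + 1))
  have hε : 0 < ε := by positivity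
  have hεR : ε * R < h x₀ := by
    have : ε * (R + 1) = h x₀ / 2 := by simp only [ε]; field_simp
    nlinarith
  have hgc : Continuous fun x => h x + ε * ‖x‖ ^ 2 := by fun_prop
  obtain ⟨z, hz, hmax⟩ := hK.exists_isMaxOn ⟨x₀, hx₀⟩ hgc.continuousOn
  have hzge : h x₀ ≤ h z + ε * ‖z‖ ^ 2 := by
    have := hmax hx₀
    simp only [mem_ofPred_eq] at this
    nlinarith [sq_nonneg ‖x₀‖]
  have hzΩ : z ∈ Ω := by
    by_contra hzΩ
    have h1 := hle z (by rw [hΩ.frontier_eq]; exact ⟨hz, hzΩ⟩)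
    have h2 := hR z hz
    rw [Real.norm_of_nonneg (sq_nonneg _)] at h2
    nlinarith
  have hcd : ContDiffAt ℝ 2 (fun x : E d => ‖x‖ ^ 2) z := (contDiff_norm_sq ℝ).contDiffAt
  have hcd' : ContDiffAt ℝ 2 (ε • fun x : E d => ‖x‖ ^ 2) z := hcd.const_smul ε
  refine not_isLocalMax_of_laplacian_pos (g := h + ε • fun x : E d => ‖x‖ ^ 2)
    ((hh z hzΩ).1.add hcd') ?_ ?_
  · rw [(hh z hzΩ).1.laplacian_add hcd', laplacian_smul ε hcd, laplacian_norm_sq,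
      (hh z hzΩ).2.self_of_nhds]
    have : (0 : ℝ) < d := by exact_mod_cast hd
    simp only [Pi.zero_apply, zero_add, smul_eq_mul]
    positivity
  · filter_upwards [hΩ.mem_nhds hzΩ] with y hy
    exact hmax (subset_closure hy)

/-- Two harmonic extensions with the same interface values agree on the closed fluid domain: the
maximum principle applies to the components of their difference. -/
theorem IsALEDisp.eqOn_closure (hd : 0 < d) {G : Geometry d} {k : ℕ∞} {T : ℝ}
    {η η' ηf ηf' : ℝ → E d → E d} (h : IsALEDisp G k T η ηf) (h' : IsALEDisp G k T η' ηf') {t : ℝ}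
    (ht : t ∈ Icc 0 T) (hη : EqOn (η t) (η' t) G.Γ) :
    EqOn (ηf t) (ηf' t) (closure G.Ωf) := by
  have key : ∀ {η η' ηf ηf' : ℝ → E d → E d}, IsALEDisp G k T η ηf → IsALEDisp G k T η' ηf' →
      EqOn (η t) (η' t) G.Γ → ∀ (i : Fin d), ∀ x ∈ closure G.Ωf, (ηf t - ηf' t) x i ≤ 0 := by
    intro η η' ηf ηf' h h' hη i
    have hc : Continuous (ηf t - ηf' t) :=
      (h.smooth.continuous.comp (Continuous.prodMk_right t)).sub
        (h'.smooth.continuous.comp (Continuous.prodMk_right t))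
    have hh := ((h.harmonic t ht).sub (h'.harmonic t ht)).comp_CLM
      (EuclideanSpace.proj (𝕜 := ℝ) i)
    refine le_zero_of_harmonicOnNhd hd G.lipf.isOpen G.lipf.isBounded
      ((EuclideanSpace.proj (𝕜 := ℝ) i).continuous.comp hc) hh fun x hx => ?_
    have : ηf t x = ηf' t x := by
      by_cases hxΓ : x ∈ G.Γ
      · rw [h.onInterface t ht x hxΓ, h'.onInterface t ht x hxΓ, hη hxΓ]
      · rw [h.onOuter t ht x ⟨hx, hxΓ⟩, h'.onOuter t ht x ⟨hx, hxΓ⟩]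
    simp [this]
  intro x hx
  ext i
  have h1 := key h h' hη i x hx
  have h2 := key h' h hη.symm i x hx
  simp only [Pi.sub_apply, PiLp.sub_apply] at h1 h2
  linarith

/-! ### Quintuples that agree have the same weak forms -/

open Classical in
/-- Equality holds everywhere, also off the image of `Φ`, where `invFunOn` takes a default value
that does not depend on `Φ`. -/
theorem push_congr {F : Type*} {Φ Φ' : E d → E d} {Ω : Set (E d)} (h : EqOn Φ Φ' (closure Ω))
    (f : E d → F) : push Φ Ω f = push Φ' Ω f := by
  have : Function.invFunOn Φ (closure Ω) = Function.invFunOn Φ' (closure Ω) := by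
    ext1 y
    have hP : ∀ a, (a ∈ closure Ω ∧ Φ a = y) = (a ∈ closure Ω ∧ Φ' a = y) := fun a =>
      propext (and_congr_right fun ha => by rw [h ha])
    exact congrArg (fun P : E d → Prop => if h : ∃ a, P a then h.choose else Classical.choice
      (inferInstance : Nonempty (E d))) (funext hP)
  rw [push, push, this]

open Classical in
theorem weakPartial_congr {Ω : Set (E d)} (hΩ : MeasurableSet Ω) (j : Fin d) {f f' : E d → ℝ}
    (h : EqOn f f' Ω) : weakPartial Ω j f = weakPartial Ω j f' := by
  have hP : ∀ g, HasWeakPartial Ω j f g = HasWeakPartial Ω j f' g := fun g => by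
    refine propext (forall_congr' fun θ => forall_congr' fun _ => forall_congr' fun _ =>
      forall_congr' fun _ => ?_)
    rw [setIntegral_congr_fun hΩ fun x hx => by rw [h hx]]
  exact congrArg (fun P : (E d → ℝ) → Prop => if h : ∃ g, MemLp g 2 (volume.restrict Ω) ∧ P g
    then h.choose else 0) (funext hP)

theorem jac_congr {Ω : Set (E d)} (hΩ : MeasurableSet Ω) {v v' : E d → E d} (h : EqOn v v' Ω) :
    jac Ω v = jac Ω v' := by
  ext x i j
  exact congrFun (weakPartial_congr hΩ j fun y hy => by simp only [h hy]) x

section Same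

variable {G : Geometry d} {T : ℝ} {D : Data G T} {k : ℕ∞} {S S' : State G}

theorem State.Same.symm (h : State.Same T S S') : State.Same T S' S where
  u t ht := (h.u t ht).symm
  p := h.p.mono fun _ ht => ht.symm
  η t ht x hx := (h.η t ht x hx).symm
  ξ t ht := (h.ξ t ht).symm
  φ t ht := (h.φ t ht).symm

theorem IsAdmissible.continuous_η (hS : IsAdmissible D k S) (t : ℝ) : Continuous (S.η t) :=
  hS.smooth_η.continuous.comp (Continuous.prodMk_right t)

theorem State.Same.eqOn_η_closure (h : State.Same T S S') (hS : IsAdmissible D k S)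
    (hS' : IsAdmissible D k S') {t : ℝ} (ht : t ∈ Icc 0 T) :
    EqOn (S.η t) (S'.η t) (closure G.Ωp) :=
  EqOn.closure (fun x hx => h.η t ht x hx) (hS.continuous_η t) (hS'.continuous_η t)

theorem State.Same.eqOn_aleDisp (hd : 0 < d) (h : State.Same T S S') (hS : IsAdmissible D k S)
    (hS' : IsAdmissible D k S') {t : ℝ} (ht : t ∈ Icc 0 T) :
    EqOn (aleDisp G k T S.η t) (aleDisp G k T S'.η t) (closure G.Ωf) :=
  hS.ale.eqOn_closure hd hS'.ale ht ((h.eqOn_η_closure hS hS' ht).mono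
    (G.partp.subset_frontier.trans frontier_subset_closure))

/-- All forms of the coupled problem only see the quintuple on the time interval, with displacements
on the closed reference domains. -/
theorem State.Same.isCoupledSolution (hd : 0 < d) {P : Params G} (h : State.Same T S S')
    (hS : IsCoupledSolution P k T S D) (hS' : IsAdmissible D k S') :
    IsCoupledSolution P k T S' D := by
  refine ⟨hS', ?_⟩
  filter_upwards [hS.weak, h.p, ae_restrict_mem measurableSet_Ioo] with t hw hp ht
  have htI : t ∈ Icc 0 T := Ioo_subset_Icc_self ht
  have hnear : ∀ᶠ s in 𝓝 t, s ∈ Icc 0 T :=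
    (isOpen_Ioo.eventually_mem ht).mono fun s hs => Ioo_subset_Icc_self hs
  have hale := fun {s : ℝ} (hs : s ∈ Icc 0 T) => h.eqOn_aleDisp hd hS.admissible hS' hs
  have hΦf : EqOn (S.Φf k T t) (S'.Φf k T t) (closure G.Ωf) := fun x hx => by
    simp only [State.Φf, aleMap, hale htI hx]
  have hΦp : EqOn (S.Φp t) (S'.Φp t) (closure G.Ωp) := fun x hx => by
    simp only [State.Φp, lagMap, h.eqOn_η_closure hS.admissible hS' htI hx]
  have hpf : ∀ {F : Type} (f : E d → F), S.pushf k T t f = S'.pushf k T t f := fun f =>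
    push_congr hΦf f
  have hpp : ∀ {F : Type} (f : E d → F), S.pushp t f = S'.pushp t f := fun f => push_congr hΦp f
  have hΩ : S.Ωf k T t = S'.Ωf k T t := image_congr (hΦf.mono subset_closure)
  have hΓ : S.Γ k T t = S'.Γ k T t := image_congr
    (hΦf.mono (G.partf.subset_frontier.trans frontier_subset_closure))
  have hN : S.SfN k T t = S'.SfN k T t := by
    obtain ⟨U, -, hU⟩ := G.partf.relOpenC
    exact image_congr (hΦf.mono
      ((hU ▸ inter_subset_right : G.SfN ⊆ frontier G.Ωf).trans frontier_subset_closure))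
  have hdu : deriv S.u t = deriv S'.u t :=
    Filter.EventuallyEq.deriv_eq (hnear.mono fun s hs => h.u s hs)
  have hdξ : deriv S.ξ t = deriv S'.ξ t :=
    Filter.EventuallyEq.deriv_eq (hnear.mono fun s hs => h.ξ s hs)
  have hdφ : deriv S.φ t = deriv S'.φ t :=
    Filter.EventuallyEq.deriv_eq (hnear.mono fun s hs => h.φ s hs)
  have hu := h.u t htI
  have hξ := h.ξ t htI
  have hφ := h.φ t htI
  have hjη : jac G.Ωp (S.η t) = jac G.Ωp (S'.η t) :=
    jac_congr G.lipp.isOpen.measurableSet fun x hx => h.η t htI x hx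
  have hdη : div G.Ωp (S.η t) = div G.Ωp (S'.η t) := by
    ext x; rw [div, div, hjη]
  have huE : S.uE k T t = S'.uE k T t := by simp only [State.uE, hpf, hu]
  have hpE : S.pE k T t = S'.pE k T t := by simp only [State.pE, hpf, hp]
  have hdtu : S.dtuE k T t = S'.dtuE k T t := by simp only [State.dtuE, hpf, hdu]
  have hΩm : MeasurableSet (S'.Ωf k T t) := by
    have hcont : Continuous (S'.Φf k T t) :=
      continuous_id.add (hS'.ale.smooth.continuous.comp (Continuous.prodMk_right t))
    exact G.lipf.isOpen.measurableSet.image_of_continuousOn_injOn hcont.continuousOn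
      ((hS'.invertible_Φf t htI).1.mono subset_closure)
  -- The domain velocities agree only on the current domain: elsewhere `invFunOn` may leave the
  -- closure of the reference domain.
  have hw' : EqOn (S.wE k T t) (S'.wE k T t) (S'.Ωf k T t) := by
    rintro _ ⟨x, hx, rfl⟩
    rw [State.wE, hpf]
    have hmem : Function.invFunOn (S'.Φf k T t) (closure G.Ωf) (S'.Φf k T t x) ∈ closure G.Ωf :=
      Function.invFunOn_apply_mem (subset_closure hx)
    exact Filter.EventuallyEq.deriv_eq (hnear.mono fun s hs => hale hs hmem)
  have hconv : ∀ V : E d → E d,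
      pair (volume.restrict (S'.Ωf k T t))
        (convect (S'.Ωf k T t) (fun x => S'.uE k T t x - S.wE k T t x) (S'.uE k T t)) V
      = pair (volume.restrict (S'.Ωf k T t))
        (convect (S'.Ωf k T t) (fun x => S'.uE k T t x - S'.wE k T t x) (S'.uE k T t)) V := by
    intro V
    refine setIntegral_congr_fun hΩm fun x hx => ?_
    simp only [convect, hw' hx]
  intro v q ζ ψ hv hq hζ hψ
  have := hw v q ζ ψ hv hq hζ hψ
  simpa only [fluidForm, incompForm, coupledFluidInterface, structForm, poreForm,
    coupledBiotInterface, fluidLoad, strainPair, symGrad, State.nf, State.uCur, State.ξCur,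
    State.φCur, State.uRef, State.ξRef, State.φRef, hpf, hpp, hΩ, hΓ, hN, huE, hpE, hdtu, hconv,
    hjη, hdη, hu, hξ, hφ, hdξ, hdφ] using this

end Same

/-! ### Square integrability on the interfaces -/

theorem MemVectorSpace.memLp_trace {Ω S A B C : Set (E d)} (hpart : IsBoundaryPartition Ω A B C)
    {v : E d → E d} (hv : MemVectorSpace Ω S v) : MemLp (trace Ω v) 2 (surf A) :=
  hv.2.1.1.mono_measure (surf_mono hpart.subset_frontier)

theorem MemScalarSpace.memLp_trace {Ω S A B C : Set (E d)} (hpart : IsBoundaryPartition Ω A B C)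
    {f : E d → ℝ} (hf : MemScalarSpace Ω S f) : MemLp (trace Ω f) 2 (surf A) :=
  hf.2.1.1.mono_measure (surf_mono hpart.subset_frontier)

section Interface

variable {G : Geometry d} {T : ℝ} {D : Data G T} {k : ℕ∞} {S : State G} {t : ℝ}

theorem IsAdmissible.contDiff_Φf (hS : IsAdmissible D k S) (hk : 1 ≤ k) (t : ℝ) :
    ContDiff ℝ 1 (S.Φf k T t) :=
  contDiff_id.add ((hS.ale.smooth.of_le (by exact_mod_cast hk)).comp
    (contDiff_const.prodMk contDiff_id))

theorem IsAdmissible.contDiff_Φp (hS : IsAdmissible D k S) (hk : 1 ≤ k) (t : ℝ) :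
    ContDiff ℝ 1 (S.Φp t) :=
  contDiff_id.add ((hS.smooth_η.of_le (by exact_mod_cast hk)).comp
    (contDiff_const.prodMk contDiff_id))

theorem Geometry.Γ_subset_closure_Ωf (G : Geometry d) : G.Γ ⊆ closure G.Ωf :=
  G.partf.subset_frontier.trans frontier_subset_closure

theorem Geometry.Γ_subset_closure_Ωp (G : Geometry d) : G.Γ ⊆ closure G.Ωp :=
  G.partp.subset_frontier.trans frontier_subset_closure

theorem Geometry.isFiniteMeasure_surf_Γ (G : Geometry d) : IsFiniteMeasure (surf G.Γ) := by
  have := G.lipf.isFiniteMeasure_surf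
  exact isFiniteMeasure_of_le _ (surf_mono G.partf.subset_frontier)

theorem IsAdmissible.memLp_pushf {F : Type*} [NormedAddCommGroup F] (hS : IsAdmissible D k S)
    (hk : 1 ≤ k) (ht : t ∈ Icc 0 T) {f : E d → F} (hf : MemLp f 2 (surf G.Γ)) :
    MemLp (S.pushf k T t f) 2 (surf (S.Γ k T t)) :=
  memLp_push G.lipf.isCompact_closure (hS.invertible_Φf t ht) (hS.contDiff_Φf hk t)
    G.partf.measurableSet G.Γ_subset_closure_Ωf hf

/-- The Lagrangian and the ALE map agree on the interface, so structure fields can also be pushed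
forward to `Γ(t)`. -/
theorem IsAdmissible.memLp_pushp {F : Type*} [NormedAddCommGroup F] (hS : IsAdmissible D k S)
    (hk : 1 ≤ k) (ht : t ∈ Icc 0 T) {f : E d → F} (hf : MemLp f 2 (surf G.Γ)) :
    MemLp (S.pushp t f) 2 (surf (S.Γ k T t)) := by
  have hΓ : S.Γ k T t = S.Φp t '' G.Γ := image_congr fun x hx => by
    rw [State.Φf, aleMap, State.Φp, lagMap, hS.ale.onInterface t ht x hx]
  rw [hΓ]
  exact memLp_push G.lipp.isCompact_closure (hS.invertible_Φp t ht) (hS.contDiff_Φp hk t)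
    G.partp.measurableSet G.Γ_subset_closure_Ωp hf

/-- The interface values of the unknowns at time `t` are square integrable, both on the reference
and on the current interface. -/
structure InterfaceMemLp (k : ℕ∞) (T : ℝ) (S : State G) (t : ℝ) : Prop where
  uRef : MemLp (S.uRef t) 2 (surf G.Γ)
  ξRef : MemLp (S.ξRef t) 2 (surf G.Γ)
  φRef : MemLp (S.φRef t) 2 (surf G.Γ)
  uCur : MemLp (S.uCur k T t) 2 (surf (S.Γ k T t))
  ξCur : MemLp (S.ξCur t) 2 (surf (S.Γ k T t))
  φCur : MemLp (S.φCur t) 2 (surf (S.Γ k T t))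

theorem IsAdmissible.ae_interfaceMemLp (hS : IsAdmissible D k S) (hk : 1 ≤ k) :
    ∀ᵐ t ∂(volume.restrict (Ioo 0 T)), InterfaceMemLp k T S t := by
  filter_upwards [hS.mem_u, hS.mem_ξ, hS.mem_φ, ae_restrict_mem measurableSet_Ioo]
    with t hu hξ hφ ht
  have htI := Ioo_subset_Icc_self ht
  have hu' := hu.memLp_trace G.partf
  have hξ' := hξ.memLp_trace G.partp
  have hφ' := hφ.memLp_trace G.partp
  exact ⟨hu', hξ', hφ', hS.memLp_pushf hk htI hu', hS.memLp_pushp hk htI hξ',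
    hS.memLp_pushp hk htI hφ'⟩

/-! ### The residual of the coupled problem at a decoupled solution -/

variable (P : Params G) (L1 L2 L3 : ℝ) (R : RobinData d)

/-- Defect of the compatibility condition for `R1`. -/
noncomputable def defect1 (k : ℕ∞) (T : ℝ) (S : State G) (t : ℝ) (x : E d) : ℝ :=
  R.R1 t x - (L1 * nrm (S.nf k T t) (S.uCur k T t) x - S.φCur t x)

/-- Defect of the compatibility condition for `R2`. -/
noncomputable def defect2 (k : ℕ∞) (T : ℝ) (S : State G) (t : ℝ) (x : E d) : E d :=
  R.R2 t x - P.γ • tan (S.nf k T t) (S.ξCur t) x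

/-- Defect of the compatibility condition for `R3`. -/
noncomputable def defect3 (S : State G) (t : ℝ) (x : E d) : ℝ :=
  R.R3 t x - L2 * nrm G.np (S.ξRef t) x

/-- Defect of the compatibility condition for `R4`. -/
noncomputable def defect4 (S : State G) (t : ℝ) (x : E d) : ℝ :=
  R.R4 t x - (L3 * S.φRef t x - nrm G.np (S.uRef t) x)

/-- Defect of the compatibility condition for `R5`. -/
noncomputable def defect5 (S : State G) (t : ℝ) (x : E d) : E d :=
  R.R5 t x - P.γ • tan G.np (S.uRef t) x

variable {P L1 L2 L3 R}

theorem isCompatible_iff_defect : IsCompatible P k T S L1 L2 L3 R ↔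
    ∀ᵐ t ∂(volume.restrict (Ioo 0 T)),
      ((∀ᵐ x ∂(surf (S.Γ k T t)), defect1 L1 R k T S t x = 0) ∧
        ∀ᵐ x ∂(surf (S.Γ k T t)), defect2 P R k T S t x = 0) ∧
      ((∀ᵐ x ∂(surf G.Γ), defect3 L2 R S t x = 0) ∧ ∀ᵐ x ∂(surf G.Γ), defect5 P R S t x = 0) ∧
      ∀ᵐ x ∂(surf G.Γ), defect4 L3 R S t x = 0 := by
  simp only [defect1, defect2, defect3, defect4, defect5, sub_eq_zero, eventually_and]
  exact ⟨fun h => ⟨⟨h.c1, h.c2⟩, ⟨h.c3, h.c5⟩, h.c4⟩,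
    fun h => ⟨h.1.1, h.1.2, h.2.1.1, h.2.2, h.2.1.2⟩⟩

/-- The defects of the compatibility conditions at time `t` are square integrable. -/
structure DefectMemLp (P : Params G) (k : ℕ∞) (T : ℝ) (S : State G) (L1 L2 L3 : ℝ)
    (R : RobinData d) (t : ℝ) : Prop where
  d1 : MemLp (defect1 L1 R k T S t) 2 (surf (S.Γ k T t))
  d2 : MemLp (defect2 P R k T S t) 2 (surf (S.Γ k T t))
  d3 : MemLp (defect3 L2 R S t) 2 (surf G.Γ)
  d4 : MemLp (defect4 L3 R S t) 2 (surf G.Γ)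
  d5 : MemLp (defect5 P R S t) 2 (surf G.Γ)

theorem IsRobinData.ae_defectMemLp (hR : IsRobinData k T S R) (hS : IsAdmissible D k S)
    (hk : 1 ≤ k) : ∀ᵐ t ∂(volume.restrict (Ioo 0 T)), DefectMemLp P k T S L1 L2 L3 R t := by
  filter_upwards [hS.ae_interfaceMemLp hk, hR.mem1.1, hR.mem2.1, hR.mem3.1, hR.mem4.1, hR.mem5.1]
    with t h h1 h2 h3 h4 h5
  exact
    ⟨h1.sub (((memLp_nrm _ h.uCur).const_mul L1).sub h.φCur),
      h2.sub ((memLp_tan _ h.ξCur).const_smul P.γ),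
      h3.sub ((memLp_nrm _ h.ξRef).const_mul L2),
      h4.sub ((h.φRef.const_mul L3).sub (memLp_nrm _ h.uRef)),
      h5.sub ((memLp_tan _ h.uRef).const_smul P.γ)⟩

/-- Summing the decoupled equations gives the coupled equation, up to the pairings of the test
functions with the defects of the compatibility conditions. -/
theorem IsDecoupledSolution.coupled_eq_add_defect (hk : 1 ≤ k) (hR : IsRobinData k T S R)
    (hS : IsDecoupledSolution P k T S L1 L2 L3 R D) :
    ∀ᵐ t ∂(volume.restrict (Ioo 0 T)), ∀ (v : E d → E d) (q : E d → ℝ)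
      (ζ : E d → E d) (ψ : E d → ℝ),
      MemVectorSpace G.Ωf G.SfD v → MemLp q 2 (volume.restrict G.Ωf) →
      MemVectorSpace G.Ωp G.SpD ζ → MemScalarSpace G.Ωp G.SpD ψ →
      fluidForm P k T S t v + incompForm k T S t q + coupledFluidInterface P k T S t v
        + structForm P S t ζ + poreForm P S t ψ + coupledBiotInterface P S t ζ ψ
      = fluidLoad k T S t D v + poreLoad T t D ψ
        + (pair (surf (S.Γ k T t)) (defect1 L1 R k T S t)
              (nrm (S.nf k T t) (S.pushf k T t (trace G.Ωf v)))
            + pair (surf (S.Γ k T t)) (defect2 P R k T S t)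
              (tan (S.nf k T t) (S.pushf k T t (trace G.Ωf v))))
        + (pair (surf G.Γ) (defect3 L2 R S t) (nrm G.np (trace G.Ωp ζ))
            + pair (surf G.Γ) (defect5 P R S t) (tan G.np (trace G.Ωp ζ)))
        + pair (surf G.Γ) (defect4 L3 R S t) (trace G.Ωp ψ) := by
  filter_upwards [hS.momentum, hS.incompressible, hS.structure_eq, hS.pore_eq,
    hS.admissible.ae_interfaceMemLp hk, hR.mem1.1, hR.mem2.1, hR.mem3.1, hR.mem4.1, hR.mem5.1,
    ae_restrict_mem measurableSet_Ioo] with t e1 e2 e3 e4 h h1 h2 h3 h4 h5 ht v q ζ ψ hv hq hζ hψ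
  have htI := Ioo_subset_Icc_self ht
  have hV := hS.admissible.memLp_pushf hk htI (hv.memLp_trace G.partf)
  have hZ := hζ.memLp_trace G.partp
  have hΨ := hψ.memLp_trace G.partp
  have hnV : MemLp (nrm (S.nf k T t) (S.pushf k T t (trace G.Ωf v))) 2 (surf (S.Γ k T t)) :=
    memLp_nrm _ hV
  have htV : MemLp (tan (S.nf k T t) (S.pushf k T t (trace G.Ωf v))) 2 (surf (S.Γ k T t)) :=
    memLp_tan _ hV
  have hnZ : MemLp (nrm G.np (trace G.Ωp ζ)) 2 (surf G.Γ) := memLp_nrm _ hZ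
  have htZ : MemLp (tan G.np (trace G.Ωp ζ)) 2 (surf G.Γ) := memLp_tan _ hZ
  have hnu : MemLp (nrm (S.nf k T t) (S.uCur k T t)) 2 (surf (S.Γ k T t)) := memLp_nrm _ h.uCur
  have htu : MemLp (tan (S.nf k T t) (S.uCur k T t)) 2 (surf (S.Γ k T t)) := memLp_tan _ h.uCur
  have htξ : MemLp (tan (S.nf k T t) (S.ξCur t)) 2 (surf (S.Γ k T t)) := memLp_tan _ h.ξCur
  have hnu' : MemLp (nrm G.np (S.uRef t)) 2 (surf G.Γ) := memLp_nrm _ h.uRef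
  have htu' : MemLp (tan G.np (S.uRef t)) 2 (surf G.Γ) := memLp_tan _ h.uRef
  have hnξ' : MemLp (nrm G.np (S.ξRef t)) 2 (surf G.Γ) := memLp_nrm _ h.ξRef
  have htξ' : MemLp (tan G.np (S.ξRef t)) 2 (surf G.Γ) := memLp_tan _ h.ξRef
  have r1 : pair (surf (S.Γ k T t)) (defect1 L1 R k T S t)
      (nrm (S.nf k T t) (S.pushf k T t (trace G.Ωf v))) = _ :=
    (pair_sub_left h1 ((hnu.const_mul L1).sub h.φCur) hnV).trans (congrArg _
      ((pair_sub_left (hnu.const_mul L1) h.φCur hnV).trans (by rw [pair_mul_left])))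
  have r2 : pair (surf (S.Γ k T t)) (defect2 P R k T S t)
      (tan (S.nf k T t) (S.pushf k T t (trace G.Ωf v))) = _ :=
    (pair_sub_left h2 (htξ.const_smul P.γ) htV).trans (congrArg _ (pair_smul_left _ _ _))
  have r3 : pair (surf G.Γ) (defect3 L2 R S t) (nrm G.np (trace G.Ωp ζ)) = _ :=
    (pair_sub_left h3 (hnξ'.const_mul L2) hnZ).trans (congrArg _ (pair_mul_left _ _ _))
  have r4 : pair (surf G.Γ) (defect4 L3 R S t) (trace G.Ωp ψ) = _ :=
    (pair_sub_left h4 ((h.φRef.const_mul L3).sub hnu') hΨ).trans (congrArg _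
      ((pair_sub_left (h.φRef.const_mul L3) hnu' hΨ).trans (by rw [pair_mul_left])))
  have r5 : pair (surf G.Γ) (defect5 P R S t) (tan G.np (trace G.Ωp ζ)) = _ :=
    (pair_sub_left h5 (htu'.const_smul P.γ) htZ).trans (congrArg _ (pair_smul_left _ _ _))
  have c1 : pair (surf (S.Γ k T t)) (tan (S.nf k T t) fun x => S.uCur k T t x - S.ξCur t x)
      (tan (S.nf k T t) (S.pushf k T t (trace G.Ωf v))) = _ :=
    (congrArg (fun f => pair _ f _) (funext (tan_sub _ _ _))).trans (pair_sub_left htu htξ htV)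
  have c2 : pair (surf G.Γ) (tan G.np fun x => S.uRef t x - S.ξRef t x)
      (tan G.np (trace G.Ωp ζ)) = _ :=
    (congrArg (fun f => pair _ f _) (funext (tan_sub _ _ _))).trans (pair_sub_left htu' htξ' htZ)
  have c3 : pair (surf G.Γ) (nrm G.np fun x => S.ξRef t x - S.uRef t x) (trace G.Ωp ψ) = _ :=
    (congrArg (fun f => pair _ f _) (funext (nrm_sub _ _ _))).trans (pair_sub_left hnξ' hnu' hΨ)
  have c4 : pair (surf G.Γ) (fun x => S.φRef t x + L2 * nrm G.np (S.ξRef t) x)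
      (nrm G.np (trace G.Ωp ζ)) = _ :=
    (pair_add_left h.φRef (hnξ'.const_mul L2) hnZ).trans (congrArg _ (pair_mul_left _ _ _))
  have e1 := e1 v hv
  have e2 := e2 q hq
  have e3 := e3 ζ hζ
  have e4 := e4 ψ hψ
  simp only [coupledFluidInterface, coupledBiotInterface]
  rw [c4] at e3
  rw [r1, r2, r3, r4, r5, c1, c2, c3]
  linear_combination e1 + e2 + e3 + e4

theorem memVectorSpace_zero {Ω A B C : Set (E d)} (hΩ : IsLipschitzDomain Ω)
    (hpart : IsBoundaryPartition Ω A B C) : MemVectorSpace Ω B fun _ => 0 := by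
  obtain ⟨U, -, hU⟩ := hpart.relOpenA
  simpa using memVectorSpace_of_contDiff hΩ hpart hU (θ := fun _ => 0) contDiff_const
    HasCompactSupport.zero (by simp [tsupport]) 0

theorem memScalarSpace_zero {Ω A B C : Set (E d)} (hΩ : IsLipschitzDomain Ω)
    (hpart : IsBoundaryPartition Ω A B C) : MemScalarSpace Ω B fun _ => 0 := by
  obtain ⟨U, -, hU⟩ := hpart.relOpenA
  exact memScalarSpace_of_contDiff hΩ hpart hU contDiff_const
    HasCompactSupport.zero (by simp [tsupport])

theorem trace_zero_ae {F : Type*} [NormedAddCommGroup F] {Ω A B C : Set (E d)}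
    (hΩ : IsLipschitzDomain Ω) (hpart : IsBoundaryPartition Ω A B C) :
    ∀ᵐ x ∂(surf A), trace Ω (fun _ => (0 : F)) x = 0 :=
  ae_mono (surf_mono hpart.subset_frontier)
    (trace_ae_eq_of_continuous hΩ continuous_const HasCompactSupport.zero)

theorem ae_nrm_eq_zero {μ : Measure (E d)} {n v : E d → E d} (h : ∀ᵐ x ∂μ, v x = 0) :
    ∀ᵐ x ∂μ, nrm n v x = 0 := h.mono fun x hx => by simp [nrm, hx]

theorem ae_tan_eq_zero {μ : Measure (E d)} {n v : E d → E d} (h : ∀ᵐ x ∂μ, v x = 0) :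
    ∀ᵐ x ∂μ, tan n v x = 0 := h.mono fun x hx => by simp [tan, tangProj, hx]

/-- A decoupled solution solves the coupled problem exactly if its Robin data are compatible. -/
theorem IsDecoupledSolution.isCoupledSolution_iff (hk : 1 ≤ k) (hR : IsRobinData k T S R)
    (hS : IsDecoupledSolution P k T S L1 L2 L3 R D) :
    IsCoupledSolution P k T S D ↔ IsCompatible P k T S L1 L2 L3 R := by
  rw [isCompatible_iff_defect]
  constructor
  · intro hC
    filter_upwards [hC.weak, hS.coupled_eq_add_defect hk hR,
      hR.ae_defectMemLp (P := P) (L1 := L1) (L2 := L2) (L3 := L3) hS.admissible hk,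
      hR.tangential2, hR.tangential5, ae_restrict_mem measurableSet_Ioo]
      with t hw hdef hL ht2 ht5 ht
    have htI := Ioo_subset_Icc_self ht
    have hinv := hS.admissible.invertible_Φf t htI
    have hΦ := hS.admissible.contDiff_Φf hk t
    have hcl := G.lipf.isCompact_closure
    have hΓm := G.partf.measurableSet
    have hΓs := G.Γ_subset_closure_Ωf
    have := G.isFiniteMeasure_surf_Γ
    have : IsFiniteMeasure (surf (S.Φf k T t '' G.Γ)) :=
      isFiniteMeasure_surf_image hcl hinv hΦ hΓm hΓs
    have hres := fun v q ζ ψ hv hq hζ hψ =>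
      (hdef v q ζ ψ hv hq hζ hψ).symm.trans (hw v q ζ ψ hv hq hζ hψ)
    have v0 := memVectorSpace_zero G.lipf G.partf
    have q0 : MemLp (fun _ => (0 : ℝ)) 2 (volume.restrict G.Ωf) := MemLp.zero
    have ζ0 := memVectorSpace_zero G.lipp G.partp
    have ψ0 := memScalarSpace_zero G.lipp G.partp
    have tv : ∀ᵐ y ∂(surf (S.Γ k T t)), S.pushf k T t (trace G.Ωf fun _ => (0 : E d)) y = 0 :=
      ae_surf_image hcl hinv hΦ hΓm hΓs (trace_zero_ae G.lipf G.partf)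
    have tζ : ∀ᵐ y ∂(surf G.Γ), trace G.Ωp (fun _ => (0 : E d)) y = 0 :=
      trace_zero_ae G.lipp G.partp
    have tψ : ∀ᵐ y ∂(surf G.Γ), trace G.Ωp (fun _ => (0 : ℝ)) y = 0 :=
      trace_zero_ae G.lipp G.partp
    -- The fluid, structure and pore-pressure test functions are varied one at a time.
    refine ⟨?_, ?_, ?_⟩
    · refine ae_eq_zero_of_pair_nrm_add_pair_tan (Φ := S.Φf k T t) (Ω' := S.Ωf k T t)
        G.lipf G.partf (aemeasurable_invFunOn_surf hcl hinv hΦ hΓm hΓs)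
        hΦ.continuous.measurable (ae_invFunOn_eq hinv hΦ hΓm hΓs)
        (ae_surf_image hcl hinv hΦ hΓm hΓs)
        (ae_exists_isOuterNormal_image G.lipf hinv hΦ hΓm G.partf.subset_frontier)
        hL.d1 hL.d2 ?_ fun v hv => ?_
      · filter_upwards [ht2] with y hy
        change tangProj (S.nf k T t y) _ = _
        rw [defect2, tangProj_sub, hy]
        congr 1
        exact (map_smul _ _ _).trans (congrArg _ (tangProj_tangProj _ _))
      · have := hres v _ _ _ hv q0 ζ0 ψ0
        rw [pair_eq_zero_right (ae_nrm_eq_zero tζ), pair_eq_zero_right (ae_tan_eq_zero tζ),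
          pair_eq_zero_right tψ] at this
        change pair (surf (S.Γ k T t)) _ (nrm (S.nf k T t) (S.pushf k T t (trace G.Ωf v)))
          + pair (surf (S.Γ k T t)) _ (tan (S.nf k T t) (S.pushf k T t (trace G.Ωf v))) = 0
        linear_combination this
    · refine ae_eq_zero_of_pair_nrm_add_pair_tan (Φ := id) (Ψ := id) (Ω' := G.Ωp)
        G.lipp G.partp aemeasurable_id measurable_id (Eventually.of_forall fun _ => rfl)
        (fun h => h) ?_ hL.d3 hL.d5 ?_ fun ζ hζ => ?_
      · filter_upwards [ae_mono (surf_mono G.partp.subset_frontier) G.lipp.ae_hasDefiningFunction]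
          with x hx using hx.exists_isOuterNormal
      · filter_upwards [ht5] with y hy
        change tangProj (G.np y) _ = _
        rw [defect5, tangProj_sub, hy]
        congr 1
        exact (map_smul _ _ _).trans (congrArg _ (tangProj_tangProj _ _))
      · have := hres _ _ ζ _ v0 q0 hζ ψ0
        rw [pair_eq_zero_right (ae_nrm_eq_zero tv), pair_eq_zero_right (ae_tan_eq_zero tv),
          pair_eq_zero_right tψ] at this
        change pair _ _ (nrm G.np (trace G.Ωp ζ)) + pair _ _ (tan G.np (trace G.Ωp ζ)) = 0
        linear_combination this
    · refine ae_eq_zero_of_pair_trace G.lipp G.partp hL.d4 fun ψ hψ => ?_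
      have := hres _ _ _ ψ v0 q0 ζ0 hψ
      rw [pair_eq_zero_right (ae_nrm_eq_zero tv), pair_eq_zero_right (ae_tan_eq_zero tv),
        pair_eq_zero_right (ae_nrm_eq_zero tζ), pair_eq_zero_right (ae_tan_eq_zero tζ)] at this
      linear_combination this
  · intro h
    refine ⟨hS.admissible, ?_⟩
    filter_upwards [h, hS.coupled_eq_add_defect hk hR] with t hz hdef v q ζ ψ hv hq hζ hψ
    rw [hdef v q ζ ψ hv hq hζ hψ, pair_eq_zero_left hz.1.1, pair_eq_zero_left hz.1.2,
      pair_eq_zero_left hz.2.1.1, pair_eq_zero_left hz.2.1.2, pair_eq_zero_left hz.2.2]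
    ring

end Interface

end NSBiot

theorem theorem3p1 {d : ℕ} (hd : d = 2 ∨ d = 3) (G : NSBiot.Geometry d) (P : NSBiot.Params G)
    (T : ℝ) (hT : 0 < T) (D : NSBiot.Data G T) (k : ℕ∞) (hk : 1 ≤ k)
    (L1 L2 L3 : ℝ) (R : NSBiot.RobinData d) (S Sr : NSBiot.State G)
    (hS : NSBiot.IsCoupledSolution P k T S D)
    (huniq : ∀ S' : NSBiot.State G, NSBiot.IsCoupledSolution P k T S' D →
      NSBiot.State.Same T S' S)
    (hR : NSBiot.IsRobinData k T Sr R)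
    (hSr : NSBiot.IsDecoupledSolution P k T Sr L1 L2 L3 R D) :
    NSBiot.State.Same T S Sr ↔ NSBiot.IsCompatible P k T Sr L1 L2 L3 R := by
  rw [← hSr.isCoupledSolution_iff hk hR]
  exact ⟨fun h => h.isCoupledSolution (by omega) hS hSr.admissible, fun h => (huniq Sr h).symm⟩
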